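/- Let $D$ be a finite digraph (no parallel arcs), $r\in V(D)$ and $k\ge 0$ an integer. An $r$-out-branching of $D$ is a spanning subdigraph of $D$ that is an oriented tree in which $r$ is the only vertex of in-degree $0$; its leaves are its vertices of out-degree $0$. A vertex set $S$ (respectively an arc $uv$) *disconnects* a vertex $w$ from $r$ if every directed path from $r$ to $w$ in $D$ contains a vertex of $S$ (respectively the arc $uv$). For a path $P$, let $V(P)$ be its vertex set and $D[V(P)]$ the subdigraph it induces; the outside of $P$ is $V(D)\setminus V(P)$. Call $(D,r)$ *reduced* if none of the following reduction rules can be applied, i.e. none of the following situations occurs: 1. (Reachability) some vertex is not reachable from $r$; 2. (Useless arc) there are vertices $u,v$ such that $\{u\}$ disconnects $v$ from $r$ and $vu\in A(D)$; 3. (Bridge) some arc $uv\in A(D)$ disconnects at least two vertices from $r$; 4. (Avoidable arc) there are an arc $vw\in A(D)$ and a set $S\subseteq V(D)\setminus\{v\}$ with $|S|\le 2$ such that $S$ disconnects $v$ from $r$ and $xw\in A(D)$ for all $x\in S$; 5. (Two directional path) there are a path $P=p_1p_2\cdots p_l$ in $D$ with $l\in\{7,8\}$ and vertices $p_{in}\in\{p_{l-1},p_l\}$,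 $p_{out}\in\{p_1,p_2\}$ such that: the vertices of $P$ with in-arcs from the outside of $P$ are exactly $p_1$ and $p_{in}$; the vertices of $P$ with out-arcs to the outside of $P$ are exactly $p_l$ and $p_{out}$; $P$ is the unique out-branching of $D[V(P)]$ rooted at $p_1$; some path $Q$ is the unique out-branching of $D[V(P)]$ rooted at $p_{in}$; and the vertex after $p_{out}$ on $P$ is not the vertex after $p_l$ on $Q$. Suppose that $(D,r)$ is reduced and that $D$ has no $r$-out-branching with at least $k$ leaves. Then $|V(D)|\le 1540\,k^3$. -/

import Mathlib

namespace RootedLeaf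

variable {V : Type*}

/-- `P` lists the vertices, in order, of a directed path of `D` from `a` to `b`
(no vertex is repeated; the one-vertex path is allowed). -/
structure IsPath (D : Digraph V) (a b : V) (P : List V) : Prop where
  chain : P.IsChain D.Adj
  nodup : P.Nodup
  start : P.head? = some a
  finish : P.getLast? = some b

/-- `uv` is an arc of the path `P`: `v` comes immediately after `u` in the list `P`. -/
def ArcOf (P : List V) (u v : V) : Prop := [u, v] <:+: P

/-- The path `P`, regarded as a set of arcs. -/
def pathDigraph (P : List V) : Digraph V where
  Adj u v := ArcOf P u v

/-- The vertex set `S` disconnects `w` from `r`: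
every path of `D` from `r` to `w` contains a vertex of `S`. -/
def SetDisconnects (D : Digraph V) (r : V) (S : Set V) (w : V) : Prop :=
  ∀ P : List V, IsPath D r w P → ∃ x ∈ S, x ∈ P

/-- The arc `uv` disconnects `w` from `r`: every path of `D` from `r` to `w` contains `uv`. -/
def ArcDisconnects (D : Digraph V) (r u v w : V) : Prop :=
  ∀ P : List V, IsPath D r w P → ArcOf P u v

/-- `T` is (the arc set of) an out-branching, rooted at `q`, of the subdigraph `D[X]` induced
by `X`: its arcs are arcs of `D[X]`, the root has in-degree `0`, every other vertex of `X` has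
in-degree exactly `1`, and every vertex of `X` is reached from the root. -/
structure IsOutBranchingOn (D : Digraph V) (X : Set V) (q : V) (T : Digraph V) : Prop where
  root_mem : q ∈ X
  arcs : ∀ u v, T.Adj u v → D.Adj u v ∧ u ∈ X ∧ v ∈ X
  root_in : ∀ u, ¬ T.Adj u q
  parent : ∀ v ∈ X, v ≠ q → ∃! u, T.Adj u v
  reach : ∀ v ∈ X, Relation.ReflTransGen T.Adj q v

/-- `T` is an `r`-out-branching of `D`. -/
def IsOutBranching (D : Digraph V) (r : V) (T : Digraph V) : Prop :=
  IsOutBranchingOn D Set.univ r T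

/-- The number of leaves (vertices of out-degree `0`) of a spanning subdigraph `T`. -/
noncomputable def numLeaves (T : Digraph V) : ℕ := {v : V | ∀ w, ¬ T.Adj v w}.ncard

/-- `(D, r, k)` is a yes-instance of Rooted `k`-Leaf Out-Branching:
`D` has an `r`-out-branching with at least `k` leaves. -/
def IsYesInstance (D : Digraph V) (r : V) (k : ℕ) : Prop :=
  ∃ T : Digraph V, IsOutBranching D r T ∧ k ≤ numLeaves T

/-- The Reachability Rule applies: some vertex is disconnected from the root. -/
def ReachabilityRuleApplies (D : Digraph V) (r : V) : Prop :=
  ∃ u, ¬ ∃ P : List V, IsPath D r u P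

/-- The Useless Arc Rule applies (to the arc `vu`): `u` disconnects `v` from the root. -/
def UselessArcRuleApplies (D : Digraph V) (r : V) : Prop :=
  ∃ u v, SetDisconnects D r {u} v ∧ D.Adj v u

/-- The Bridge Rule applies (to the arc `uv`):
`uv` disconnects at least two vertices from the root. -/
def BridgeRuleApplies (D : Digraph V) (r : V) : Prop :=
  ∃ u v, D.Adj u v ∧ ∃ w₁ w₂, w₁ ≠ w₂ ∧ ArcDisconnects D r u v w₁ ∧ ArcDisconnects D r u v w₂

/-- The Avoidable Arc Rule applies (to the arc `vw`): a set `S` of at most two vertices, all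
different from `v`, disconnects `v` from the root, and `vw` and all `xw`, `x ∈ S`, are arcs. -/
def AvoidableArcRuleApplies (D : Digraph V) (r : V) : Prop :=
  ∃ (S : Finset V) (v w : V), S.card ≤ 2 ∧ v ∉ S ∧ SetDisconnects D r (S : Set V) v ∧
    D.Adj v w ∧ ∀ x ∈ S, D.Adj x w

/-- The configuration to which the Two Directional Path Rule applies: a path
`P = p₁ p₂ … pₗ` of `D` with `l ∈ {7, 8}`, vertices `pIn ∈ {pₗ₋₁, pₗ}` and `pOut ∈ {p₁, p₂}`,
and a path `Q`. -/
structure TwoDirectionalPath (D : Digraph V) (P Q : List V) (p₁ pₗ pIn pOut : V) : Prop where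
  length : P.length = 7 ∨ P.length = 8
  isPath : IsPath D p₁ pₗ P
  pIn_eq : P[P.length - 2]? = some pIn ∨ pIn = pₗ
  pOut_eq : pOut = p₁ ∨ P[1]? = some pOut
  /-- the vertices of `P` with in-arcs from the outside of `P` are exactly `p₁` and `pIn` -/
  in_arcs : ∀ x ∈ P, (∃ y, y ∉ P ∧ D.Adj y x) ↔ (x = p₁ ∨ x = pIn)
  /-- the vertices of `P` with out-arcs to the outside of `P` are exactly `pₗ` and `pOut` -/
  out_arcs : ∀ x ∈ P, (∃ y, y ∉ P ∧ D.Adj x y) ↔ (x = pₗ ∨ x = pOut)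
  /-- `P` is the unique out-branching of `D[V(P)]` rooted at `p₁` -/
  unique_P : ∀ T : Digraph V, IsOutBranchingOn D {x | x ∈ P} p₁ T ↔ T = pathDigraph P
  isPath_Q : ∃ b, IsPath D pIn b Q
  /-- `Q` is the unique out-branching of `D[V(P)]` rooted at `pIn` -/
  unique_Q : ∀ T : Digraph V, IsOutBranchingOn D {x | x ∈ P} pIn T ↔ T = pathDigraph Q
  /-- the vertex after `pOut` on `P` differs from the vertex after `pₗ` on `Q` -/
  next_ne : ∀ x y, ArcOf P pOut x → ArcOf Q pₗ y → x ≠ y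

/-- The Two Directional Path Rule applies. -/
def TwoDirectionalPathRuleApplies (D : Digraph V) : Prop :=
  ∃ (P Q : List V) (p₁ pₗ pIn pOut : V), TwoDirectionalPath D P Q p₁ pₗ pIn pOut

/-- `(D, r)` is a reduced instance: none of the five reduction rules applies. -/
structure IsReduced (D : Digraph V) (r : V) : Prop where
  reachability : ¬ ReachabilityRuleApplies D r
  useless_arc : ¬ UselessArcRuleApplies D r
  bridge : ¬ BridgeRuleApplies D r
  avoidable_arc : ¬ AvoidableArcRuleApplies D r
  two_directional_path : ¬ TwoDirectionalPathRuleApplies D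

end RootedLeaf

namespace RootedLeaf

open Relation

/-! Put `k = n + 1`, so that every `r`-out-branching has at most `n` leaves. A set of vertices or
arcs is bounded by building an out-branching whose leaves witness its size.

A breadth-first tree has at most `n` leaves and fewer than `n` branching vertices. It therefore
splits into fewer than `2n` unary chains, and a quadratic bound for one chain suffices
(`card_le_of_reduced`). Breadth-first search excludes forward jumps on a chain. By the Bridge rule
the chain, extended by at most one vertex, can be avoided on the way to every other vertex
(`exists_isIsolatedPath`). Any forest on such a path, rooted at its entries, then extends to an
out-branching of `D` that keeps the leaves of the forest (`IsIsolatedPath.card_leaves_le`).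

On the path, consider the canonical forest that prefers the last later in-neighbour as parent. Its
leaves bound the entries, branching vertices and siblings. Exchanging parents bounds the vertices
that could be moved without closing a cycle, either to another later in-neighbour or to their
predecessor (`card_switch_le_of_separated`). Cutting at entries, siblings and exchangeable vertices
leaves at most `6n` unary pieces. On these, the path is two-way up to blocks consisting of a forced
vertex and its predecessor.

All other arcs from the path go to at most `7n` targets, among them at most `3n` exits
(`card_exits_le`). The Avoidable Arc rule allows each piece at most two in-neighbours of each
target, hence at most `2 · 6n · 7n` ports (`no_common_outNeighbor`). Nine consecutive vertices free
of cuts, ports, leaves and branchings, and not including the last vertex of the path, would contain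
a configuration for the Two Directional Path rule, so the path has length `O(n²)` (`length_le`). -/

theorem reflTransGen_mono {α : Type*} {R R' : α → α → Prop} {a b : α} (h : ReflTransGen R a b)
    (hR : ∀ x y, R x y → R' x y) : ReflTransGen R' a b := by
  induction h with
  | refl => exact .refl
  | tail _ h ih => exact ih.tail (hR _ _ h)

/-! ### Reachability, and local consequences of the reduction rules -/

section Walks

variable {V : Type*} {D : Digraph V} {r : V}

theorem reflTransGen_of_isChain {R : V → V → Prop} :
    ∀ {P : List V} {a b : V}, P.IsChain R → P.head? = some a → P.getLast? = some b →
      ReflTransGen R a b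
  | [], a, b, _, h, _ => by simp at h
  | [x], a, b, _, h, h' => by
    simp at h h'
    subst h h'
    exact .refl
  | x :: y :: l, a, b, hc, h, h' => by
    rw [List.isChain_cons_cons] at hc
    simp at h
    subst h
    exact .head hc.1 (reflTransGen_of_isChain hc.2 (by simp) (by simpa using h'))

theorem IsPath.reflTransGen {a b : V} {P : List V} (h : IsPath D a b P) :
    ReflTransGen (fun x y => D.Adj x y ∧ ArcOf P x y) a b := by
  refine reflTransGen_of_isChain ?_ h.start h.finish
  have hc := h.chain
  rw [List.isChain_iff_forall_rel_of_append_cons_cons] at hc ⊢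
  intro x y l₁ l₂ hP
  exact ⟨hc hP, l₁, l₂, by simp [hP]⟩

theorem ArcOf.mem_left {P : List V} {u v : V} (h : ArcOf P u v) : u ∈ P :=
  h.subset (by simp)

theorem ArcOf.mem_right {P : List V} {u v : V} (h : ArcOf P u v) : v ∈ P :=
  h.subset (by simp)

/-- A path from `r` to `w` must enter `C`, and arcs enter `C` only from `S`. -/
theorem setDisconnects_of_closed {S C : Set V} {w : V} (hr : r ∉ C) (hw : w ∈ C)
    (hC : ∀ u v, D.Adj u v → v ∈ C → u ∈ C ∨ u ∈ S) : SetDisconnects D r S w := by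
  intro P hP
  by_contra! hS
  have key : ∀ v, ReflTransGen (fun x y => D.Adj x y ∧ ArcOf P x y) r v → v ∉ C := by
    intro v hv
    induction hv with
    | refl => exact hr
    | tail _ huv ih =>
      intro hvC
      rcases hC _ _ huv.1 hvC with h | h
      · exact ih h
      · exact hS _ h huv.2.mem_left
  exact key w hP.reflTransGen hw

theorem reflTransGen_of_not_setDisconnects {S : Set V} {w : V}
    (h : ¬ SetDisconnects D r S w) :
    ReflTransGen (fun x y => D.Adj x y ∧ y ∉ S) r w := by
  simp only [SetDisconnects, not_forall] at h
  obtain ⟨P, hP, hS⟩ := h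
  push Not at hS
  exact reflTransGen_mono hP.reflTransGen fun x y hxy => ⟨hxy.1, fun hy => hS _ hy hxy.2.mem_right⟩

theorem reflTransGen_of_not_arcDisconnects {u v w : V} (h : ¬ ArcDisconnects D r u v w) :
    ReflTransGen (fun x y => D.Adj x y ∧ ¬ (x = u ∧ y = v)) r w := by
  simp only [ArcDisconnects, not_forall] at h
  obtain ⟨P, hP, hS⟩ := h
  refine reflTransGen_mono hP.reflTransGen fun x y hxy => ⟨hxy.1, ?_⟩
  rintro ⟨rfl, rfl⟩
  exact hS hxy.2

variable (hred : IsReduced D r)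
include hred

theorem IsReduced.reachable (v : V) : ReflTransGen D.Adj r v := by
  have := hred.reachability
  simp only [ReachabilityRuleApplies, not_exists] at this
  obtain ⟨P, hP⟩ := not_forall_not.1 (this v)
  exact reflTransGen_mono hP.reflTransGen fun x y h => h.1

theorem IsReduced.not_adj_root (v : V) : ¬ D.Adj v r := by
  intro h
  refine hred.useless_arc ⟨r, v, fun P hP => ⟨r, rfl, ?_⟩, h⟩
  exact List.mem_of_head? hP.start

theorem IsReduced.not_adj_self (v : V) : ¬ D.Adj v v := by
  intro h
  refine hred.useless_arc ⟨v, v, fun P hP => ⟨v, rfl, ?_⟩, h⟩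
  exact List.mem_of_getLast? hP.finish

theorem IsReduced.not_adj_of_unique_in {u v : V} (hv : v ≠ r) (h : ∀ w, D.Adj w v → w = u) :
    ¬ D.Adj v u := by
  intro hvu
  refine hred.useless_arc ⟨u, v, fun P hP => ⟨u, rfl, ?_⟩, hvu⟩
  rcases hP.reflTransGen.cases_tail with h1 | ⟨w, _, hw⟩
  · exact absurd h1 hv
  · exact h w hw.1 ▸ hw.2.mem_left

/-- If two consecutive vertices each have a single in-arc, the first of these arcs lies on every
path to either vertex, against the Bridge rule. -/
theorem IsReduced.not_unique_in_twice {u v w : V} (hv : v ≠ r) (hw : w ≠ r) (huv : D.Adj u v)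
    (hvw : D.Adj v w)
    (h : ∀ x, D.Adj x v → x = u) (h' : ∀ x, D.Adj x w → x = v) : False := by
  have hne : v ≠ w := by
    rintro rfl
    exact hred.not_adj_self _ hvw
  refine hred.bridge ⟨u, v, huv, v, w, hne, fun P hP => ?_, fun P hP => ?_⟩
  · rcases hP.reflTransGen.cases_tail with h1 | ⟨x, _, hx⟩
    · exact absurd h1 hv
    · exact h x hx.1 ▸ hx.2
  · rcases hP.reflTransGen.cases_tail with h1 | ⟨x, hx', hx⟩
    · exact absurd h1 hw
    · obtain rfl := h' x hx.1
      rcases hx'.cases_tail with h1 | ⟨y, _, hy⟩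
      · exact absurd h1 hv
      · exact h y hy.1 ▸ hy.2

end Walks

/-! ### Breadth-first search -/

section BFS

variable {V : Type*}

/-- `v` is the end of a walk of length `n` from `r` along the relation `R`. -/
def ReachIn (R : V → V → Prop) (r : V) : ℕ → V → Prop
  | 0, v => v = r
  | n + 1, v => ∃ u, ReachIn R r n u ∧ R u v

theorem exists_reachIn {R : V → V → Prop} {r v : V} (h : ReflTransGen R r v) :
    ∃ n, ReachIn R r n v := by
  induction h with
  | refl => exact ⟨0, rfl⟩
  | tail _ h ih =>
    obtain ⟨n, hn⟩ := ih
    exact ⟨n + 1, _, hn, h⟩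

theorem ReachIn.reflTransGen {R : V → V → Prop} {r : V} :
    ∀ {n : ℕ} {v : V}, ReachIn R r n v → ReflTransGen R r v
  | 0, v, h => by
    obtain rfl : v = r := h
    exact .refl
  | n + 1, v, ⟨u, hu, huv⟩ => hu.reflTransGen.tail huv

/-- Breadth-first search along a relation: a depth function and a parent function. -/
theorem exists_bfs (R : V → V → Prop) (r : V) :
    ∃ (d : V → ℕ) (t : V → V),
      (∀ v, ReflTransGen R r v → v ≠ r →
        ReflTransGen R r (t v) ∧ R (t v) v ∧ d v = d (t v) + 1) ∧
      ∀ u v, ReflTransGen R r u → R u v → d v ≤ d u + 1 := by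
  classical
  let d : V → ℕ := fun v => sInf {n | ReachIn R r n v}
  have hd : ∀ v, ReflTransGen R r v → ReachIn R r (d v) v := fun v hv =>
    Nat.sInf_mem (s := {n | ReachIn R r n v}) (exists_reachIn hv)
  have hle : ∀ v n, ReachIn R r n v → d v ≤ n := fun v n h => Nat.sInf_le h
  have hstep : ∀ u v, ReflTransGen R r u → R u v → d v ≤ d u + 1 := fun u v hu huv =>
    hle _ _ ⟨u, hd u hu, huv⟩
  have hpar : ∀ v, ∃ u, ReflTransGen R r v → v ≠ r →
      ReflTransGen R r u ∧ R u v ∧ d v = d u + 1 := by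
    intro v
    by_cases h : ReflTransGen R r v ∧ v ≠ r
    · have h1 := hd v h.1
      rcases hn : d v with _ | n
      · rw [hn] at h1
        exact absurd h1 h.2
      · rw [hn] at h1
        obtain ⟨u, hu, huv⟩ := h1
        refine ⟨u, fun _ _ => ⟨hu.reflTransGen, huv, ?_⟩⟩
        have h2 := hle u n hu
        have h3 := hstep u v hu.reflTransGen huv
        omega
    · exact ⟨v, fun h1 h2 => absurd ⟨h1, h2⟩ h⟩
  choose t ht using hpar
  exact ⟨d, t, ht, hstep⟩

end BFS

/-! ### Out-branchings with prescribed leaves -/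

section Leaves

variable {V : Type*} {D : Digraph V} {r : V} {n : ℕ}

/-- In a no-instance, a spanning out-tree given by a parent function has few leaves. -/
theorem ncard_leaves_le (hno : ¬ IsYesInstance D r (n + 1)) (t : V → V) (ρ : V → ℕ)
    (ht : ∀ v, v ≠ r → D.Adj (t v) v ∧ ρ (t v) < ρ v) :
    {v | ∀ w, w ≠ r → t w ≠ v}.ncard ≤ n := by
  by_contra! hlt
  refine hno ⟨⟨fun u v => v ≠ r ∧ t v = u⟩, ⟨trivial, ?_, ?_, ?_, ?_⟩, ?_⟩
  · rintro u v ⟨hv, rfl⟩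
    exact ⟨(ht v hv).1, trivial, trivial⟩
  · rintro u ⟨h, _⟩
    exact h rfl
  · intro v _ hv
    exact ⟨t v, ⟨hv, rfl⟩, fun y hy => hy.2.symm⟩
  · intro v _
    induction h : ρ v using Nat.strong_induction_on generalizing v with
    | _ m ih =>
      by_cases hv : v = r
      · subst hv
        exact .refl
      · exact (ih _ (h ▸ (ht v hv).2) (t v) trivial rfl).tail ⟨hv, rfl⟩
  · have : {v : V | ∀ w, ¬ (w ≠ r ∧ t w = v)} = {v | ∀ w, w ≠ r → t w ≠ v} := by
      ext v
      simp only [Set.mem_ofPred_eq, not_and]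
    rw [numLeaves]
    simp only [this]
    exact hlt

/-- In a no-instance, few vertices can simultaneously be reached from the root without
leaving one of them. -/
theorem card_le_of_reachable_avoiding [Fintype V] (hred : IsReduced D r)
    (hno : ¬ IsYesInstance D r (n + 1)) (Z : Finset V) (hr : r ∉ Z)
    (hZ : ∀ z ∈ Z, ReflTransGen (fun u v => D.Adj u v ∧ u ∉ Z) r z) : Z.card ≤ n := by
  classical
  obtain ⟨d₁, t₁, h₁, -⟩ := exists_bfs (fun u v => D.Adj u v ∧ u ∉ Z) r
  obtain ⟨d₂, t₂, h₂, -⟩ := exists_bfs D.Adj r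
  set U : Set V := {v | ReflTransGen (fun u v => D.Adj u v ∧ u ∉ Z) r v} with hU
  set B := Finset.univ.sup d₁ + 1 with hB
  have hdB : ∀ v, d₁ v < B := fun v => Nat.lt_succ_of_le (Finset.le_sup (Finset.mem_univ v))
  let t : V → V := fun v => if v = r then r else if v ∈ U then t₁ v else t₂ v
  -- Outside `U`, parents come from a search in all of `D` and may lie in `U`, even in `Z`. The
  -- offset `B` ranks them below every such vertex.
  let ρ : V → ℕ := fun v => if v ∈ U then d₁ v else B + d₂ v
  have hrU : r ∈ U := ReflTransGen.refl
  have ht : ∀ v, v ≠ r → D.Adj (t v) v ∧ ρ (t v) < ρ v := by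
    intro v hv
    by_cases hvU : v ∈ U
    · obtain ⟨ha, hb, hc⟩ := h₁ v hvU hv
      have : t₁ v ∈ U := ha
      simp only [t, ρ, hv, hvU, this, if_true, if_false]
      exact ⟨hb.1, by omega⟩
    · obtain ⟨ha, hb, hc⟩ := h₂ v (hred.reachable v) hv
      simp only [t, ρ, hv, hvU, if_false]
      refine ⟨hb, ?_⟩
      have := hdB (t₂ v)
      split_ifs <;> omega
  have htU : ∀ v ∈ U, t v ∈ U ∧ t v ∉ Z := by
    intro v hvU
    by_cases hv : v = r
    · simp only [t, hv, if_true]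
      exact ⟨hrU, hr⟩
    · obtain ⟨ha, hb, hc⟩ := h₁ v hvU hv
      simp only [t, hv, hvU, if_true, if_false]
      exact ⟨ha, hb.2⟩
  have hiter : ∀ m, ∀ v ∈ U, t^[m + 1] v ∈ U ∧ t^[m + 1] v ∉ Z := by
    intro m
    induction m with
    | zero => exact htU
    | succ m ih =>
      intro v hv
      rw [Function.iterate_succ_apply]
      exact ih _ (htU v hv).1
  -- Vertices of `Z` may gain children outside `U`, so each is charged to a leaf among its
  -- descendants: one of maximal `ρ`.
  have hleaf : ∀ z, ∃ l, (∀ w, w ≠ r → t w ≠ l) ∧ ∃ j, t^[j] l = z := by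
    intro z
    obtain ⟨l, hl, hmax⟩ := Finset.exists_max_image
      (Finset.univ.filter fun w => ∃ j, t^[j] w = z) ρ ⟨z, by simpa using ⟨0, rfl⟩⟩
    simp only [Finset.mem_filter, Finset.mem_univ, true_and] at hl hmax
    refine ⟨l, fun w hw hwl => ?_, hl⟩
    obtain ⟨j, hj⟩ := hl
    have := hmax w ⟨j + 1, by rw [Function.iterate_succ_apply, hwl, hj]⟩
    have := (ht w hw).2
    rw [hwl] at this
    omega
  choose l hl hlz using hleaf
  -- No vertex of `Z` has a proper ancestor in `Z`: ancestors of vertices of `U` stay in `U` and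
  -- avoid `Z`. Hence the leaves chosen for different vertices differ.
  have hanti : ∀ j j' z z' x, z ∈ Z → z' ∈ Z → t^[j] x = z → t^[j'] x = z' → j ≤ j' → z = z' := by
    intro j j' z z' x hz hz' hj hj' hle
    obtain ⟨m, rfl⟩ := Nat.exists_eq_add_of_le' hle
    rw [Function.iterate_add_apply, hj] at hj'
    rcases m with _ | m
    · exact hj'
    · exact absurd hz' (hj' ▸ (hiter m z (hZ z hz)).2)
  have hinj : Set.InjOn l Z := by
    intro z hz z' hz' h
    obtain ⟨j, hj⟩ := hlz z
    obtain ⟨j', hj'⟩ := hlz z'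
    rw [← h] at hj'
    rcases le_total j j' with hle | hle
    · exact hanti j j' z z' _ hz hz' hj hj' hle
    · exact (hanti j' j z' z _ hz' hz hj' hj hle).symm
  calc Z.card = (Z : Set V).ncard := (Set.ncard_coe_finset Z).symm
    _ ≤ {v | ∀ w, w ≠ r → t w ≠ v}.ncard :=
      Set.ncard_le_ncard_of_injOn l (fun z _ => hl z) hinj (Set.toFinite _)
    _ ≤ n := ncard_leaves_le hno t ρ ht

end Leaves

/-! ### Leaves, roots and branching in a finite forest -/

section Counting

/-- In a forest on `s`, with non-roots `N` and parent function `f`, the leaves outnumber the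
roots together with the excess out-degrees of the branching vertices. -/
theorem card_roots_add_sum_le {α : Type*} [DecidableEq α] (s N : Finset α) (f : α → α) (hN : N ⊆ s)
    (hf : ∀ x ∈ N, f x ∈ s) :
    (s \ N).card + ∑ v ∈ s with 2 ≤ (N.filter (f · = v)).card, ((N.filter (f · = v)).card - 1)
      ≤ (s.filter fun v => ∀ w ∈ N, f w ≠ v).card := by
  set c : α → ℕ := fun v => (N.filter (f · = v)).card with hc
  have h1 : ∑ v ∈ s, c v = N.card := (Finset.card_eq_sum_card_fiberwise hf).symm
  have h2 := Finset.card_sdiff_add_card_eq_card hN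
  have h3 : s.card = ∑ v ∈ s, 1 := by simp
  rw [Finset.sum_filter, Finset.card_filter]
  -- With `c v` children, `1 + (c v - 1)⁺ = c v + [c v = 0]`. Summing over `s` gives the inequality,
  -- in fact with equality.
  have key : ∀ v ∈ s, 1 + (if 2 ≤ c v then c v - 1 else 0)
      = c v + (if ∀ w ∈ N, f w ≠ v then 1 else 0) := by
    intro v _
    have h0 : (∀ w ∈ N, f w ≠ v) ↔ c v = 0 := by
      simp only [hc, Finset.card_eq_zero, Finset.filter_eq_empty_iff]
    simp only [h0]
    split_ifs <;> omega
  have := Finset.sum_congr rfl key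
  rw [Finset.sum_add_distrib, Finset.sum_add_distrib] at this
  simp only [hc] at *
  omega

theorem card_roots_add_card_branching_le {α : Type*} [DecidableEq α] (s N : Finset α) (f : α → α) (hN : N ⊆ s)
    (hf : ∀ x ∈ N, f x ∈ s) :
    (s \ N).card + (s.filter fun v => 2 ≤ (N.filter (f · = v)).card).card
      ≤ (s.filter fun v => ∀ w ∈ N, f w ≠ v).card := by
  refine le_trans ?_ (card_roots_add_sum_le s N f hN hf)
  rw [Finset.card_eq_sum_ones (s.filter _)]
  gcongr with v hv
  simp only [Finset.mem_filter] at hv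
  omega

/-- A branching vertex with `c ≥ 2` children has excess `c - 1 ≥ c / 2`, whence the factor `2`. -/
theorem card_roots_add_card_children_le {α : Type*} [DecidableEq α] (s N : Finset α) (f : α → α) (hN : N ⊆ s)
    (hf : ∀ x ∈ N, f x ∈ s) :
    2 * (s \ N).card + (N.filter fun x => 2 ≤ (N.filter (f · = f x)).card).card
      ≤ 2 * (s.filter fun v => ∀ w ∈ N, f w ≠ v).card := by
  have h := card_roots_add_sum_le s N f hN hf
  have h1 : (N.filter fun x => 2 ≤ (N.filter (f · = f x)).card).card
      = ∑ v ∈ s with 2 ≤ (N.filter (f · = v)).card, (N.filter (f · = v)).card := by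
    rw [Finset.card_eq_sum_card_fiberwise (f := f)
      (t := s.filter fun v => 2 ≤ (N.filter (f · = v)).card)]
    · refine Finset.sum_congr rfl fun v hv => ?_
      simp only [Finset.mem_filter] at hv
      congr 1
      ext x
      simp only [Finset.mem_filter]
      constructor
      · rintro ⟨⟨a, _⟩, rfl⟩
        exact ⟨a, rfl⟩
      · rintro ⟨a, rfl⟩
        exact ⟨⟨a, hv.2⟩, rfl⟩
    · intro x hx
      simp only [Finset.coe_filter, Set.mem_ofPred_eq] at hx ⊢
      exact ⟨hf x hx.1, hx.2⟩
  have h2 : ∑ v ∈ s with 2 ≤ (N.filter (f · = v)).card, (N.filter (f · = v)).card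
      ≤ 2 * ∑ v ∈ s with 2 ≤ (N.filter (f · = v)).card, ((N.filter (f · = v)).card - 1) := by
    rw [Finset.mul_sum]
    refine Finset.sum_le_sum fun v hv => ?_
    simp only [Finset.mem_filter] at hv
    omega
  omega

end Counting

/-! ### Isolated paths and the extension of forests on them -/

section IsolatedPath

variable {V : Type*} {D : Digraph V} {r : V} {p : ℕ → V} {l n : ℕ}

/-- `v` is none of the vertices `p 0, …, p (l - 1)`. -/
def Outside (p : ℕ → V) (l : ℕ) (v : V) : Prop := ∀ i < l, v ≠ p i

/-- `p i` has an in-arc from the outside of `p 0, …, p (l - 1)`. -/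
def Entry (D : Digraph V) (p : ℕ → V) (l i : ℕ) : Prop := ∃ u, Outside p l u ∧ D.Adj u (p i)

/-- `p 0, …, p (l - 1)` is a path avoiding `r` without forward jumps, such that
every vertex outside can be reached from `r` without using the path. -/
structure IsIsolatedPath (D : Digraph V) (r : V) (p : ℕ → V) (l : ℕ) : Prop where
  inj : ∀ i < l, ∀ j < l, p i = p j → i = j
  adj : ∀ i, i + 1 < l → D.Adj (p i) (p (i + 1))
  fwd : ∀ i < l, ∀ j < l, D.Adj (p i) (p j) → j ≤ i + 1
  root : Outside p l r
  pos : 0 < l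
  entry : Entry D p l 0
  reach : ∀ v, Outside p l v → ReflTransGen (fun x y => D.Adj x y ∧ Outside p l y) r v

theorem not_outside {v : V} : ¬ Outside p l v ↔ ∃ i < l, v = p i := by
  simp [Outside]

/-- A forest on the vertices of an isolated path, rooted at the entries, has few leaves. -/
theorem IsIsolatedPath.card_leaves_le [Fintype V] (hP : IsIsolatedPath D r p l)
    (hno : ¬ IsYesInstance D r (n + 1)) (σ ρ : ℕ → ℕ)
    (hσ : ∀ i < l, ¬ Entry D p l i → σ i < l ∧ D.Adj (p (σ i)) (p i) ∧ ρ (σ i) < ρ i)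
    (L : Finset ℕ) (hL : ∀ v ∈ L, v < l ∧ ∀ w < l, ¬ Entry D p l w → σ w ≠ v) : L.card ≤ n := by
  classical
  obtain ⟨d, t, ht, -⟩ := exists_bfs (fun x y => D.Adj x y ∧ Outside p l y) r
  set B := Finset.univ.sup d + 1 with hB
  have hdB : ∀ v, d v < B := fun v => Nat.lt_succ_of_le (Finset.le_sup (Finset.mem_univ v))
  have hidx : ∀ v, ∃ i, ¬ Outside p l v → i < l ∧ v = p i := by
    intro v
    by_cases h : Outside p l v
    · exact ⟨0, fun h' => absurd h h'⟩
    · obtain ⟨i, hi⟩ := not_outside.1 h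
      exact ⟨i, fun _ => hi⟩
  choose idx hidx using hidx
  have hent : ∀ i, ∃ u, Entry D p l i → Outside p l u ∧ D.Adj u (p i) := by
    intro i
    by_cases h : Entry D p l i
    · obtain ⟨u, hu⟩ := h
      exact ⟨u, fun _ => hu⟩
    · exact ⟨r, fun h' => absurd h' h⟩
  choose e he using hent
  have hin : ∀ i < l, ¬ Outside p l (p i) := fun i hi h => h i hi rfl
  have hidx' : ∀ i < l, idx (p i) = i := by
    intro i hi
    obtain ⟨h1, h2⟩ := hidx (p i) (hin i hi)
    exact (hP.inj _ hi _ h1 h2).symm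
  have hout : ∀ {x v}, ReflTransGen (fun x y => D.Adj x y ∧ Outside p l y) x v → Outside p l x →
      Outside p l v := by
    intro x v h hx
    induction h with
    | refl => exact hx
    | tail _ h _ => exact h.2
  -- The outside is spanned without the path, entries hang from outside vertices, and `σ` serves the
  -- rest. No outside vertex has its parent on the path, so leaves of the forest remain leaves.
  let t' : V → V := fun v => if Outside p l v then t v else
    if Entry D p l (idx v) then e (idx v) else p (σ (idx v))
  let ρ' : V → ℕ := fun v => if Outside p l v then d v else B + ρ (idx v)
  have ht' : ∀ v, v ≠ r → D.Adj (t' v) v ∧ ρ' (t' v) < ρ' v := by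
    intro v hv
    by_cases ho : Outside p l v
    · obtain ⟨h1, h2, h3⟩ := ht v (hP.reach v ho) hv
      have h4 := hout h1 hP.root
      simp only [t', ρ', ho, h4, if_true]
      exact ⟨h2.1, by omega⟩
    · obtain ⟨hi, hvi⟩ := hidx v ho
      set i := idx v with hi'
      by_cases hE : Entry D p l i
      · obtain ⟨h1, h2⟩ := he i hE
        simp only [t', ρ', ho, ← hi', hE, h1, if_true, if_false]
        refine ⟨hvi ▸ h2, ?_⟩
        have := hdB (e i)
        omega
      · obtain ⟨h1, h2, h3⟩ := hσ i hi hE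
        simp only [t', ρ', ho, ← hi', hE, hin _ h1, hidx' _ h1, if_false]
        exact ⟨hvi ▸ h2, by omega⟩
  refine le_trans ?_ (ncard_leaves_le hno t' ρ' ht')
  rw [← Set.ncard_coe_finset]
  refine Set.ncard_le_ncard_of_injOn p ?_ ?_ (Set.toFinite _)
  · intro v hv
    obtain ⟨hvl, hv⟩ := hL v hv
    intro w hw
    by_cases ho : Outside p l w
    · have h4 := hout (ht w (hP.reach w ho) hw).1 hP.root
      simp only [t', ho, if_true]
      exact h4 v hvl
    · obtain ⟨hi, hvi⟩ := hidx w ho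
      by_cases hE : Entry D p l (idx w)
      · simp only [t', ho, hE, if_true, if_false]
        exact (he _ hE).1 v hvl
      · simp only [t', ho, hE, if_false]
        intro h
        exact hv _ hi hE (hP.inj _ (hσ _ hi hE).1 _ hvl h)
  · intro i hi j hj h
    exact hP.inj i (hL i hi).1 j (hL j hj).1 h

end IsolatedPath

/-! ### Walks with few steps into a given set -/

section Cost

variable {V : Type*} {D : Digraph V} {r : V} {X : Set V}

/-- `Cost D X r n v`: there is a walk from `r` to `v`, at most `n` of whose steps enter `X`. -/
inductive Cost (D : Digraph V) (X : Set V) (r : V) : ℕ → V → Prop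
  | root (n : ℕ) : Cost D X r n r
  | free {n : ℕ} {u v : V} : Cost D X r n u → D.Adj u v → v ∉ X → Cost D X r n v
  | pay {n : ℕ} {u v : V} : Cost D X r n u → D.Adj u v → Cost D X r (n + 1) v

/-- The least number of steps entering `X` on a walk from `r` to `v`. -/
noncomputable def minCost (D : Digraph V) (X : Set V) (r v : V) : ℕ := sInf {n | Cost D X r n v}

theorem cost_minCost {v : V} (hv : ReflTransGen D.Adj r v) : Cost D X r (minCost D X r v) v := by
  refine Nat.sInf_mem (s := {n | Cost D X r n v}) ?_
  induction hv with
  | refl => exact ⟨0, .root 0⟩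
  | tail _ h ih =>
    obtain ⟨n, hn⟩ := ih
    exact ⟨n + 1, .pay hn h⟩

theorem Cost.minCost_le {n : ℕ} {v : V} (h : Cost D X r n v) : minCost D X r v ≤ n := Nat.sInf_le h

theorem minCost_root : minCost D X r r = 0 := Nat.le_zero.1 (Cost.root 0).minCost_le

theorem minCost_le_of_adj {u v : V} (hu : ReflTransGen D.Adj r u) (h : D.Adj u v) (hv : v ∉ X) :
    minCost D X r v ≤ minCost D X r u := ((cost_minCost hu).free h hv).minCost_le

theorem minCost_le_succ_of_adj {u v : V} (hu : ReflTransGen D.Adj r u) (h : D.Adj u v) :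
    minCost D X r v ≤ minCost D X r u + 1 := ((cost_minCost hu).pay h).minCost_le

theorem Cost.exists_finset [DecidableEq V] {n : ℕ} {v : V} (h : Cost D X r n v) :
    ∃ R : Finset V, R.card ≤ n ∧
      ReflTransGen (fun x y => D.Adj x y ∧ (y ∈ X → y ∈ R)) r v := by
  induction h with
  | root n => exact ⟨∅, by simp, .refl⟩
  | free _ h hv ih =>
    obtain ⟨R, hR, h1⟩ := ih
    exact ⟨R, hR, h1.tail ⟨h, fun h' => absurd h' hv⟩⟩
  | @pay n u v _ h ih =>
    obtain ⟨R, hR, h1⟩ := ih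
    refine ⟨insert v R, (Finset.card_insert_le _ _).trans (by omega), ?_⟩
    refine (reflTransGen_mono h1 fun x y hxy => ⟨hxy.1, fun hy => ?_⟩).tail
      ⟨h, fun _ => Finset.mem_insert_self _ _⟩
    exact Finset.mem_insert_of_mem (hxy.2 hy)

/-- An optimal walk to `v` ends in a part on which `minCost` is constant, starting at the root
or in `X`. -/
theorem Cost.exists_origin {n : ℕ} {v : V} (h : Cost D X r n v) (hr : ∀ v, ReflTransGen D.Adj r v)
    (hn : minCost D X r v = n) :
    ∃ o, (o = r ∨ o ∈ X) ∧
      ReflTransGen (fun x y => D.Adj x y ∧ minCost D X r x = n) o v := by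
  induction h with
  | root n => exact ⟨r, .inl rfl, .refl⟩
  | @free n u v h h' hv ih =>
    have h1 := h.minCost_le
    have h2 := minCost_le_of_adj (hr u) h' hv
    obtain ⟨o, ho, hov⟩ := ih (by omega)
    exact ⟨o, ho, hov.tail ⟨h', by omega⟩⟩
  | @pay n u v h h' _ =>
    by_cases hv : v ∈ X
    · exact ⟨v, .inr hv, .refl⟩
    · have h1 := h.minCost_le
      have h2 := minCost_le_of_adj (hr u) h' hv
      omega

/-- A walk to a vertex of cost at least `j ≥ 1` meets a vertex of `X` of cost exactly `j`. -/
theorem minCost_lt_of_avoid {j : ℕ} (hj : 0 < j) (hr : ∀ v, ReflTransGen D.Adj r v) {S : Set V}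
    (hS : ∀ x ∈ X, minCost D X r x = j → x ∈ S) {v : V}
    (h : ReflTransGen (fun x y => D.Adj x y ∧ y ∉ S) r v) : minCost D X r v < j := by
  induction h with
  | refl => rwa [minCost_root]
  | @tail u v _ h ih =>
    have h1 := minCost_le_succ_of_adj (X := X) (hr u) h.1
    by_cases hv : v ∈ X
    · by_contra! hge
      exact h.2 (hS v hv (by omega))
    · exact (minCost_le_of_adj (hr u) h.1 hv).trans_lt ih

end Cost

/-! ### Out-neighbours of an isolated path -/

section Exits

variable {V : Type*} {D : Digraph V} {r : V} {p : ℕ → V} {l n : ℕ}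

theorem IsIsolatedPath.reflTransGen (hP : IsIsolatedPath D r p l) {R : V → V → Prop}
    (hR : ∀ i, i + 1 < l → R (p i) (p (i + 1))) : ∀ i < l, ReflTransGen R (p 0) (p i)
  | 0, _ => .refl
  | i + 1, hi => (hP.reflTransGen hR i (by omega)).tail (hR i hi)

open Classical in
/-- The vertices outside an isolated path with in-arcs from the path are few. -/
theorem IsIsolatedPath.card_exits_le [Fintype V] (hP : IsIsolatedPath D r p l) (hred : IsReduced D r)
    (hno : ¬ IsYesInstance D r (n + 1)) :
    (Finset.univ.filter fun x => Outside p l x ∧ ∃ i < l, D.Adj (p i) x).card ≤ 3 * n := by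
  set X : Finset V := Finset.univ.filter fun x => Outside p l x ∧ ∃ i < l, D.Adj (p i) x with hX
  have memX : ∀ {x}, x ∈ X ↔ Outside p l x ∧ ∃ i < l, D.Adj (p i) x := by simp [hX]
  have hrX : r ∉ X := by
    rw [memX]
    rintro ⟨-, i, -, h⟩
    exact hred.not_adj_root _ h
  have hpX : ∀ i < l, p i ∉ X := fun i hi h => (memX.1 h).1 i hi rfl
  set f := minCost D (X : Set V) r with hf
  set m := f (p 0) with hm
  have hreach := hred.reachable
  -- the exits not on a cheapest walk to `p 0`
  have h1 : X.card ≤ n + m := by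
    obtain ⟨R, hR, hw⟩ := (cost_minCost (X := (X : Set V)) (hreach (p 0))).exists_finset
    -- A cheapest walk to `p 0`, continued along the path, leaves no vertex of `X \ R`, yet reaches
    -- an in-neighbour of each of them.
    have h2 : (X \ R).card ≤ n := by
      refine card_le_of_reachable_avoiding hred hno _ (fun h => hrX (Finset.mem_sdiff.1 h).1) ?_
      intro z hz
      obtain ⟨-, i, hi, hz'⟩ := memX.1 (Finset.mem_sdiff.1 hz).1
      have hw1 : ∀ v, ReflTransGen (fun x y => D.Adj x y ∧ (y ∈ (X : Set V) → y ∈ R)) r v →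
          ReflTransGen (fun u v => D.Adj u v ∧ u ∉ X \ R) r v ∧ v ∉ X \ R := by
        intro v hv
        induction hv with
        | refl => exact ⟨.refl, fun h => hrX (Finset.mem_sdiff.1 h).1⟩
        | tail _ h ih =>
          refine ⟨ih.1.tail ⟨h.1, ih.2⟩, fun h' => ?_⟩
          rw [Finset.mem_sdiff] at h'
          exact h'.2 (h.2 h'.1)
      have hout : ∀ i < l, p i ∉ X \ R := fun i hi h => hpX i hi (Finset.mem_sdiff.1 h).1
      exact ((hw1 _ hw).1.trans (hP.reflTransGen
        (fun j hj => ⟨hP.adj j hj, hout j (by omega)⟩) i hi)).tail ⟨hz', hout i hi⟩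
    have h3 := Finset.card_le_card_sdiff_add_card (s := X) (t := R)
    have h4 : R.card ≤ m := hR
    omega
  set lev : ℕ → Finset V := fun j => X.filter fun x => f x = j with hlev
  have hone : ∀ j ∈ Finset.Icc 1 m, 1 ≤ (lev j).card := by
    intro j hj
    rw [Finset.mem_Icc] at hj
    by_contra! hlt
    have h0 : lev j = ∅ := by
      rw [← Finset.card_eq_zero]
      omega
    have : m < j := minCost_lt_of_avoid (X := (X : Set V)) (j := j) hj.1 hreach (S := ∅) (v := p 0)
      (fun x hx hxj => by
        have : x ∈ lev j := by simp only [hlev, Finset.mem_filter]; exact ⟨hx, hxj⟩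
        simp [h0] at this)
      (reflTransGen_mono (hreach _) fun x y h => ⟨h, by simp⟩)
    omega
  set J := (Finset.Icc 1 m).filter fun j => (lev j).card = 1 with hJ
  -- a single exit of its cost is entered from a path vertex of one cost less
  have hJp : ∀ j ∈ J, ∃ i < l, f (p i) + 1 = j := by
    intro j hj
    simp only [hJ, Finset.mem_filter, Finset.mem_Icc] at hj
    obtain ⟨y, hy⟩ := Finset.card_eq_one.1 hj.2
    have hyj : y ∈ lev j := by simp [hy]
    simp only [hlev, Finset.mem_filter] at hyj
    obtain ⟨-, i, hi, hiy⟩ := memX.1 hyj.1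
    refine ⟨i, hi, ?_⟩
    have h2 : ¬ SetDisconnects D r {y} (p i) := fun h => hred.useless_arc ⟨y, p i, h, hiy⟩
    have h3 := minCost_lt_of_avoid (X := (X : Set V)) (j := j) hj.1.1 hreach (S := {y}) (v := p i)
      (fun x hx hxj => by
        have : x ∈ lev j := by simp only [hlev, Finset.mem_filter]; exact ⟨hx, hxj⟩
        rw [hy] at this
        simpa using this)
      (reflTransGen_of_not_setDisconnects h2)
    have h4 := minCost_le_succ_of_adj (X := (X : Set V)) (hreach (p i)) hiy
    have h5 : f y = j := hyj.2
    simp only [← hf] at h3 h4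
    omega
  choose! q hq hqf using hJp
  have h2 : J.card ≤ n := by
    -- The vertices `p (q j)` have pairwise different costs `j - 1`.
    have hinj : Set.InjOn (fun j => p (q j)) J := by
      intro j hj j' hj' h
      have h1 := hqf j hj
      have h2 := hqf j' hj'
      have h3 : p (q j) = p (q j') := h
      rw [h3] at h1
      omega
    rw [← Finset.card_image_of_injOn hinj]
    have hmem : ∀ v ∈ J.image fun j => p (q j), ¬ Outside p l v := by
      intro v hv
      rw [Finset.mem_image] at hv
      obtain ⟨j, hj, rfl⟩ := hv
      exact fun h => h _ (hq j hj) rfl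
    refine card_le_of_reachable_avoiding hred hno _ (fun h => hmem _ h hP.root) ?_
    intro z hz
    obtain ⟨j, hj, rfl⟩ := Finset.mem_image.1 hz
    obtain ⟨o, ho, hoz⟩ := (cost_minCost (X := (X : Set V)) (hreach (p (q j)))).exists_origin
      hreach rfl
    have hoo : Outside p l o := by
      rcases ho with rfl | ho
      · exact hP.root
      · exact (memX.1 ho).1
    have hro : ReflTransGen (fun u v => D.Adj u v ∧ u ∉ J.image fun j => p (q j)) r o := by
      have hh := hP.reach o hoo
      have : ∀ v, ReflTransGen (fun x y => D.Adj x y ∧ Outside p l y) r v →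
          ReflTransGen (fun u v => D.Adj u v ∧ u ∉ J.image fun j => p (q j)) r v ∧
            Outside p l v := by
        intro v hv
        induction hv with
        | refl => exact ⟨.refl, hP.root⟩
        | tail _ h ih => exact ⟨ih.1.tail ⟨h.1, fun h' => hmem _ h' ih.2⟩, h.2⟩
      exact (this o hh).1
    -- The last part of a cheapest walk to `p (q j)` keeps the cost of its end, and no other `p (q
    -- j')` has that cost. It starts outside the path, at a vertex reachable without the path.
    have key : ∀ v, ReflTransGen (fun x y => D.Adj x y ∧
        minCost D (X : Set V) r x = minCost D (X : Set V) r (p (q j))) o v →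
        ReflTransGen (fun u v => D.Adj u v ∧ u ∉ J.image fun j => p (q j)) r (p (q j)) ∨
        ReflTransGen (fun u v => D.Adj u v ∧ u ∉ J.image fun j => p (q j)) r v := by
      intro v hv
      induction hv with
      | refl => exact .inr hro
      | @tail x y _ h ih =>
        rcases ih with ih | ih
        · exact .inl ih
        · by_cases hx : x ∈ J.image fun j => p (q j)
          · obtain ⟨j', hj', rfl⟩ := Finset.mem_image.1 hx
            have h1 := hqf j hj
            have h2 := hqf j' hj'
            have h3 := h.2
            simp only [← hf] at h3
            have : j' = j := by omega
            rw [this] at ih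
            exact .inl ih
          · exact .inr (ih.tail ⟨h.1, hx⟩)
    rcases key _ hoz with h | h <;> exact h
  have h3 : ∑ j ∈ Finset.Icc 1 m, (lev j).card ≤ X.card := by
    rw [← Finset.card_biUnion]
    · exact Finset.card_le_card fun x hx => by
        simp only [Finset.mem_biUnion, hlev, Finset.mem_filter] at hx
        obtain ⟨_, _, h, _⟩ := hx
        exact h
    · intro i _ j _ hij
      rw [Function.onFun, Finset.disjoint_left]
      intro x hx hx'
      simp only [hlev, Finset.mem_filter] at hx hx'
      exact hij (hx.2.symm.trans hx'.2)
  -- This yields `2m ≤ |X| + |J| ≤ |X| + n`. With `|X| ≤ n + m` it follows that `m ≤ 2n` and `|X| ≤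
  -- 3n`.
  have h4 : ∑ j ∈ Finset.Icc 1 m, 2 ≤ ∑ j ∈ Finset.Icc 1 m, ((lev j).card +
      if (lev j).card = 1 then 1 else 0) := by
    refine Finset.sum_le_sum fun j hj => ?_
    have := hone j hj
    split_ifs <;> omega
  rw [Finset.sum_add_distrib, ← Finset.card_filter, ← hJ] at h4
  simp at h4
  omega

end Exits

/-! ### Acyclicity of parent functions on a path -/

section Acyclic

open Classical in
/-- The start of the maximal run of forward parent arcs ending in `i`. -/
noncomputable def runStart (N : ℕ → Prop) (σ : ℕ → ℕ) : ℕ → ℕ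
  | 0 => 0
  | i + 1 => if N (i + 1) ∧ σ (i + 1) = i then runStart N σ i else i + 1

variable {N : ℕ → Prop} {σ : ℕ → ℕ}

theorem runStart_le : ∀ i, runStart N σ i ≤ i
  | 0 => le_rfl
  | i + 1 => by
    rw [runStart]
    split_ifs
    · exact (runStart_le i).trans (Nat.le_succ i)
    · exact le_rfl

theorem runStart_run : ∀ i t, runStart N σ i < t → t ≤ i → N t ∧ σ t + 1 = t
  | 0, t => by
    rw [runStart]
    omega
  | i + 1, t => by
    rw [runStart]
    split_ifs with h
    · intro h1 h2
      rcases Nat.lt_or_ge i t with h3 | h3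
      · obtain rfl : t = i + 1 := by omega
        exact ⟨h.1, by omega⟩
      · exact runStart_run i t h1 h3
    · omega

/-- A parent function whose arcs go forward by at most one step is acyclic, unless some backward
arc closes a run of forward arcs. -/
theorem exists_rank {l : ℕ} (h0 : ¬ N 0)
    (h1 : ∀ i < l, N i → σ i < l ∧ i ≤ σ i + 1 ∧ σ i ≠ i)
    (hrun : ∀ u v, u < v → v < l → N u → σ u = v →
      ¬ ∀ t, u < t → t ≤ v → N t ∧ σ t + 1 = t) :
    ∃ ρ : ℕ → ℕ, ∀ i < l, N i → ρ (σ i) < ρ i := by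
  -- A lexicographic rank: a forward parent arc stays in its run and raises the index. For a
  -- backward one, the run containing the parent starts strictly after the child, since otherwise it
  -- would contain the child and close a cycle.
  refine ⟨fun i => (l - runStart N σ i) * l + i, fun i hi hN => ?_⟩
  obtain ⟨h2, h3, h4⟩ := h1 i hi hN
  rcases Nat.lt_or_ge i (σ i) with h5 | h5
  · have hz : runStart N σ i = i := by
      rcases i with _ | i
      · exact absurd hN h0
      · rw [runStart, if_neg]
        omega
    have hlt : i < runStart N σ (σ i) := by
      by_contra! hle
      rcases hle.lt_or_eq with h6 | h6
      · have := (runStart_run (σ i) i h6 h5.le).2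
        omega
      · exact hrun i (σ i) h5 h2 hN rfl fun t ht ht' => runStart_run (σ i) t (by omega) ht'
    have h7 := runStart_le (N := N) (σ := σ) (σ i)
    simp only [hz]
    obtain ⟨k, hk⟩ : ∃ k, l - i = (l - runStart N σ (σ i)) + 1 + k :=
      ⟨l - i - (l - runStart N σ (σ i)) - 1, by omega⟩
    rw [hk, add_mul, add_mul]
    have : 0 ≤ k * l := Nat.zero_le _
    omega
  · obtain ⟨j, rfl⟩ : ∃ j, i = j + 1 := ⟨σ i, by omega⟩
    have h6 : σ (j + 1) = j := by omega
    have h7 : runStart N σ (j + 1) = runStart N σ j := by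
      rw [runStart, if_pos ⟨hN, h6⟩]
    simp only [h6, h7]
    omega

/-- A `2`-colouring of the graph of a function, where only the values `g v < v` matter. -/
def twoColor (g : ℕ → ℕ) (v : ℕ) : Bool := if g v < v then !(twoColor g (g v)) else false
termination_by v

theorem twoColor_of_lt {g : ℕ → ℕ} {v : ℕ} (h : g v < v) :
    twoColor g v = !(twoColor g (g v)) := by
  rw [twoColor, if_pos h]

end Acyclic

/-! ### The canonical forest and exchanges of parents -/

section Forest

open Classical in
/-- The indices of the later vertices of the path with an arc to `p i`. -/
noncomputable def backIn {V : Type*} (D : Digraph V) (p : ℕ → V) (l i : ℕ) : Finset ℕ :=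
  (Finset.range l).filter fun j => i < j ∧ D.Adj (p j) (p i)

/-- The canonical parent: the last in-neighbour if it comes later, else the preceding vertex. -/
noncomputable def par {V : Type*} (D : Digraph V) (p : ℕ → V) (l i : ℕ) : ℕ :=
  if h : (backIn D p l i).Nonempty then (backIn D p l i).max' h else i - 1

/-- The only in-neighbour of `p i` is the preceding vertex of the path. -/
def Forced {V : Type*} (D : Digraph V) (p : ℕ → V) (l i : ℕ) : Prop :=
  i < l ∧ ¬ Entry D p l i ∧ backIn D p l i = ∅

open Classical in
/-- The indices of the vertices of the path that are no entries. -/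
noncomputable def nonEntries {V : Type*} (D : Digraph V) (p : ℕ → V) (l : ℕ) : Finset ℕ :=
  (Finset.range l).filter fun i => ¬ Entry D p l i

/-- The children of `v` in the canonical forest. -/
noncomputable def kids {V : Type*} (D : Digraph V) (p : ℕ → V) (l v : ℕ) : Finset ℕ :=
  (nonEntries D p l).filter (par D p l · = v)

/-- The leaves of the canonical forest. -/
noncomputable def forestLeaves {V : Type*} (D : Digraph V) (p : ℕ → V) (l : ℕ) : Finset ℕ :=
  (Finset.range l).filter fun v => ∀ w ∈ nonEntries D p l, par D p l w ≠ v

/-- The branching vertices of the canonical forest. -/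
noncomputable def branching {V : Type*} (D : Digraph V) (p : ℕ → V) (l : ℕ) : Finset ℕ :=
  (Finset.range l).filter fun v => 2 ≤ (kids D p l v).card

/-- The vertices with a sibling in the canonical forest. -/
noncomputable def siblings {V : Type*} (D : Digraph V) (p : ℕ → V) (l : ℕ) : Finset ℕ :=
  (nonEntries D p l).filter fun x => 2 ≤ (kids D p l (par D p l x)).card

/-- The non-entries with two later in-neighbours. -/
noncomputable def multiBack {V : Type*} (D : Digraph V) (p : ℕ → V) (l : ℕ) : Finset ℕ :=
  (nonEntries D p l).filter fun y => 2 ≤ (backIn D p l y).card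

/-- Making `i - 1` the parent of `i` would close a cycle in the canonical forest. -/
def Locked {V : Type*} (D : Digraph V) (p : ℕ → V) (l i : ℕ) : Prop :=
  ∃ u v, u < i ∧ i ≤ v ∧ v < l ∧ ¬ Entry D p l u ∧ par D p l u = v ∧
    ∀ t, u < t → t ≤ v → t ≠ i → Forced D p l t

open Classical in
/-- The only children that can be moved to the preceding vertex of the path. -/
noncomputable def movable {V : Type*} (D : Digraph V) (p : ℕ → V) (l : ℕ) : Finset ℕ :=
  (nonEntries D p l).filter fun x => x ∉ siblings D p l ∧ x ∉ multiBack D p l ∧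
    (backIn D p l x).Nonempty ∧ ¬ Locked D p l x

variable {V : Type*} {D : Digraph V} {r : V} {p : ℕ → V} {l n : ℕ}

theorem mem_backIn {i j : ℕ} : j ∈ backIn D p l i ↔ j < l ∧ i < j ∧ D.Adj (p j) (p i) := by
  simp [backIn]

theorem mem_nonEntries {i : ℕ} : i ∈ nonEntries D p l ↔ i < l ∧ ¬ Entry D p l i := by
  simp [nonEntries]

theorem mem_kids {v w : ℕ} : w ∈ kids D p l v ↔ (w < l ∧ ¬ Entry D p l w) ∧ par D p l w = v := by
  simp [kids, mem_nonEntries]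

theorem par_mem_backIn {i : ℕ} (h : (backIn D p l i).Nonempty) : par D p l i ∈ backIn D p l i := by
  rw [par, dif_pos h]
  exact Finset.max'_mem _ _

theorem le_par {i j : ℕ} (h : j ∈ backIn D p l i) : j ≤ par D p l i := by
  rw [par, dif_pos ⟨j, h⟩]
  exact Finset.le_max' _ _ h

theorem par_of_empty {i : ℕ} (h : backIn D p l i = ∅) : par D p l i = i - 1 := by
  rw [par, dif_neg (by simp [h])]

theorem eq_of_par_eq {i j : ℕ} (hi : i ∈ nonEntries D p l) (hj : j ∈ nonEntries D p l)
    (h : i ∉ siblings D p l) (hij : par D p l j = par D p l i) : j = i := by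
  classical
  by_contra hne
  refine h ?_
  rw [siblings, Finset.mem_filter]
  refine ⟨hi, Finset.one_lt_card.2 ⟨j, ?_, i, ?_, hne⟩⟩
  · exact mem_kids.2 ⟨mem_nonEntries.1 hj, hij⟩
  · exact mem_kids.2 ⟨mem_nonEntries.1 hi, rfl⟩

namespace IsIsolatedPath

variable (hP : IsIsolatedPath D r p l)
include hP

theorem pos_of_not_entry {i : ℕ} (hi : ¬ Entry D p l i) : 0 < i := by
  rcases i with _ | i
  · exact absurd hP.entry hi
  · omega

theorem par_spec {i : ℕ} (hi : i < l) (hE : ¬ Entry D p l i) :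
    par D p l i < l ∧ D.Adj (p (par D p l i)) (p i) := by
  by_cases h : (backIn D p l i).Nonempty
  · have := mem_backIn.1 (par_mem_backIn h)
    exact ⟨this.1, this.2.2⟩
  · rw [par_of_empty (Finset.not_nonempty_iff_eq_empty.1 h)]
    have hpos := hP.pos_of_not_entry hE
    have h1 := hP.adj (i - 1) (by omega)
    rw [show i - 1 + 1 = i by omega] at h1
    exact ⟨by omega, h1⟩

variable (hred : IsReduced D r)
include hred

theorem eq_of_adj_forced {i : ℕ} (hi : Forced D p l i) {w : V} (hw : D.Adj w (p i)) :
    w = p (i - 1) := by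
  obtain ⟨h1, h2, h3⟩ := hi
  by_cases ho : Outside p l w
  · exact absurd ⟨w, ho, hw⟩ h2
  · obtain ⟨j, hj, rfl⟩ := not_outside.1 ho
    have h4 := hP.fwd j hj i h1 hw
    rcases Nat.lt_trichotomy j i with h | rfl | h
    · congr 1
      omega
    · exact absurd hw (hred.not_adj_self _)
    · have : j ∈ backIn D p l i := mem_backIn.2 ⟨hj, h, hw⟩
      simp [h3] at this

theorem not_adj_pred_of_forced {i : ℕ} (hi : Forced D p l i) : ¬ D.Adj (p i) (p (i - 1)) :=
  hred.not_adj_of_unique_in (fun h => hP.root i hi.1 h.symm)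
    fun _ hw => hP.eq_of_adj_forced hred hi hw

theorem not_forced_succ {i : ℕ} (hi : Forced D p l i) : ¬ Forced D p l (i + 1) := by
  intro hi'
  have hpos := hP.pos_of_not_entry hi.2.1
  have h1 := hP.adj (i - 1) (by have := hi.1; omega)
  rw [show i - 1 + 1 = i by omega] at h1
  exact hred.not_unique_in_twice (fun h => hP.root i hi.1 h.symm)
    (fun h => hP.root _ hi'.1 h.symm) h1 (hP.adj i hi'.1)
    (fun _ hw => hP.eq_of_adj_forced hred hi hw) (fun _ hw => hP.eq_of_adj_forced hred hi' hw)

/-- Forced vertices are never consecutive, so the run has one vertex and the arc goes back to its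
predecessor, against the Useless Arc rule. -/
theorem forced_run_false {u v : ℕ} (huv : u < v) (h : D.Adj (p v) (p u))
    (hrun : ∀ t, u < t → t ≤ v → Forced D p l t) : False := by
  have h1 := hrun (u + 1) (by omega) (by omega)
  rcases Nat.lt_or_ge (u + 1) v with h2 | h2
  · exact hP.not_forced_succ hred h1 (hrun (u + 2) (by omega) (by omega))
  · obtain rfl : v = u + 1 := by omega
    exact hP.not_adj_pred_of_forced hred h1 h

/-- Forests on the path, given by a parent function without closed runs, have few leaves. -/
theorem card_leaves_le_of_noRun [Fintype V] (hno : ¬ IsYesInstance D r (n + 1)) (σ : ℕ → ℕ)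
    (hσ : ∀ i < l, ¬ Entry D p l i → σ i < l ∧ D.Adj (p (σ i)) (p i))
    (hrun : ∀ u v, u < v → v < l → ¬ Entry D p l u → σ u = v →
      ¬ ∀ t, u < t → t ≤ v → ¬ Entry D p l t ∧ σ t + 1 = t)
    (L : Finset ℕ) (hL : ∀ v ∈ L, v < l ∧ ∀ w < l, ¬ Entry D p l w → σ w ≠ v) : L.card ≤ n := by
  obtain ⟨ρ, hρ⟩ := exists_rank (N := fun i => ¬ Entry D p l i) (σ := σ) (l := l)
    (not_not.2 hP.entry) (fun i hi hE => by
      obtain ⟨h1, h2⟩ := hσ i hi hE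
      refine ⟨h1, hP.fwd _ h1 _ hi h2, fun h => ?_⟩
      rw [h] at h2
      exact hred.not_adj_self _ h2) hrun
  exact hP.card_leaves_le hno σ ρ
    (fun i hi hE => ⟨(hσ i hi hE).1, (hσ i hi hE).2, hρ i hi hE⟩) L hL

/-- A vertex whose canonical parent is its predecessor is forced, so a closed run would consist of
forced vertices. -/
theorem par_noRun (u v : ℕ) (huv : u < v) (hv : v < l) (hu : ¬ Entry D p l u)
    (h : par D p l u = v) :
    ¬ ∀ t, u < t → t ≤ v → ¬ Entry D p l t ∧ par D p l t + 1 = t := by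
  intro hrun
  refine hP.forced_run_false hred huv (h ▸ (hP.par_spec (huv.trans hv) hu).2) fun t h1 h2 => ?_
  obtain ⟨h3, h4⟩ := hrun t h1 h2
  refine ⟨by omega, h3, ?_⟩
  by_contra hne
  have := (mem_backIn.1 (par_mem_backIn (Finset.nonempty_iff_ne_empty.2 hne))).2.1
  omega

theorem card_forestLeaves_le [Fintype V] (hno : ¬ IsYesInstance D r (n + 1)) :
    (forestLeaves D p l).card ≤ n := by
  refine hP.card_leaves_le_of_noRun hred hno (par D p l)
    (fun i hi hE => hP.par_spec hi hE) (hP.par_noRun hred) _ fun v hv => ?_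
  simp only [forestLeaves, Finset.mem_filter, Finset.mem_range] at hv
  exact ⟨hv.1, fun w hw hE => hv.2 w (mem_nonEntries.2 ⟨hw, hE⟩)⟩

theorem card_branching_le [Fintype V] (hno : ¬ IsYesInstance D r (n + 1)) :
    (Finset.range l \ nonEntries D p l).card + (branching D p l).card ≤ n := by
  refine Nat.le_trans ?_ (hP.card_forestLeaves_le hred hno)
  have := card_roots_add_card_branching_le (Finset.range l) (nonEntries D p l) (par D p l)
    (fun x hx => Finset.mem_range.2 (mem_nonEntries.1 hx).1) (fun x hx => by
      have := mem_nonEntries.1 hx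
      exact Finset.mem_range.2 (hP.par_spec this.1 this.2).1)
  exact this

theorem card_siblings_le [Fintype V] (hno : ¬ IsYesInstance D r (n + 1)) :
    2 * (Finset.range l \ nonEntries D p l).card + (siblings D p l).card ≤ 2 * n := by
  refine Nat.le_trans ?_ (Nat.mul_le_mul_left 2 (hP.card_forestLeaves_le hred hno))
  have := card_roots_add_card_children_le (Finset.range l) (nonEntries D p l) (par D p l)
    (fun x hx => Finset.mem_range.2 (mem_nonEntries.1 hx).1) (fun x hx => by
      have := mem_nonEntries.1 hx
      exact Finset.mem_range.2 (hP.par_spec this.1 this.2).1)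
  exact this

open Classical in
/-- If every subset of `M` can be moved from the canonical parents to the parents given by `b`,
then `M` is small. -/
theorem card_switch_le [Fintype V] (hno : ¬ IsYesInstance D r (n + 1)) (M : Finset ℕ) (b : ℕ → ℕ)
    (hM : ∀ y ∈ M, y ∈ nonEntries D p l ∧ y ∉ siblings D p l)
    (hb : ∀ y ∈ M, D.Adj (p (b y)) (p y) ∧ b y < par D p l y)
    (hrun : ∀ M' ⊆ M, ∀ u v, u < v → v < l → ¬ Entry D p l u →
      (if u ∈ M' then b u else par D p l u) = v →
      ¬ ∀ t, u < t → t ≤ v → ¬ Entry D p l t ∧ (if t ∈ M' then b t else par D p l t) + 1 = t) :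
    M.card ≤ 2 * n := by
  have hinj : ∀ y ∈ M, ∀ w, w ∈ nonEntries D p l → par D p l w = par D p l y → w = y :=
    fun y hy w hw h => eq_of_par_eq (hM y hy).1 hw (hM y hy).2 h
  -- Parents are distinct on `M`, so `par y ↦ b y` is well defined. It decreases indices, and a
  -- two-colouring therefore separates `par y` from `b y` for every `y ∈ M`.
  let g : ℕ → ℕ := fun v => if h : ∃ y ∈ M, par D p l y = v then b h.choose else v
  have hg : ∀ y ∈ M, g (par D p l y) = b y := by
    intro y hy
    have h : ∃ y' ∈ M, par D p l y' = par D p l y := ⟨y, hy, rfl⟩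
    simp only [g, dif_pos h]
    rw [hinj y hy _ (hM _ h.choose_spec.1).1 h.choose_spec.2]
  have hcol : ∀ y ∈ M, twoColor g (par D p l y) = !(twoColor g (b y)) := by
    intro y hy
    have h := twoColor_of_lt (g := g) (v := par D p l y) (by rw [hg y hy]; exact (hb y hy).2)
    rwa [hg y hy] at h
  -- Exchange exactly the members whose old parent has colour `c`. Their new parents have the other
  -- colour, and no unexchanged vertex shares an old parent, so all these old parents become leaves.
  have key : ∀ c, (M.filter fun y => twoColor g (par D p l y) = c).card ≤ n := by
    intro c
    set M' := M.filter fun y => twoColor g (par D p l y) = c with hM'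
    have hsub : M' ⊆ M := Finset.filter_subset _ _
    rw [← Finset.card_image_of_injOn (f := par D p l) (s := M')
      (fun y hy y' hy' h => hinj y' (hsub hy') y (hM y (hsub hy)).1 h)]
    refine hP.card_leaves_le_of_noRun hred hno
      (fun y => if y ∈ M' then b y else par D p l y) ?_ (hrun M' hsub) _ ?_
    · intro i hi hE
      have h := hP.par_spec hi hE
      by_cases hiM : i ∈ M'
      · simp only [hiM, if_true]
        have := hb i (hsub hiM)
        exact ⟨by omega, this.1⟩
      · simpa only [hiM, if_false] using h
    · intro v hv
      obtain ⟨y, hy, rfl⟩ := Finset.mem_image.1 hv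
      have hyn := mem_nonEntries.1 (hM y (hsub hy)).1
      refine ⟨(hP.par_spec hyn.1 hyn.2).1, fun w hw hE => ?_⟩
      by_cases hwM : w ∈ M'
      · simp only [hwM, if_true]
        intro h
        have h1 := hcol w (hsub hwM)
        have h2 := (Finset.mem_filter.1 hwM).2
        have h3 := (Finset.mem_filter.1 hy).2
        rw [h2, h, h3] at h1
        simp at h1
      · simp only [hwM, if_false]
        intro h
        exact hwM (hinj y (hsub hy) w (mem_nonEntries.2 ⟨hw, hE⟩) h ▸ hy)
  have h1 := key true
  have h2 := key false
  have h3 := Finset.card_filter_add_card_filter_not (s := M)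
    (fun y => twoColor g (par D p l y) = true)
  simp only [Bool.not_eq_true] at h3
  omega

end IsIsolatedPath

end Forest

-- Elements of `U` are numbered in increasing order. Two of equal parity cannot be neighbours in
-- this order, and the successor of the first has the other parity.
open Classical in
theorem exists_rank_separator (U : Finset ℕ) {y y' : ℕ} (hy : y ∈ U) (hlt : y < y')
    (h : (U.filter (· < y)).card % 2 = (U.filter (· < y')).card % 2) :
    ∃ z ∈ U, y < z ∧ z < y' ∧ (U.filter (· < z)).card % 2 ≠ (U.filter (· < y)).card % 2 := by
  have hnext : ∀ z, y < z → (∀ w ∈ U, w < z → w ≤ y) →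
      (U.filter (· < z)).card = (U.filter (· < y)).card + 1 := by
    intro z hz hw
    rw [← Finset.card_insert_of_notMem (a := y) (by simp)]
    congr 1
    ext w
    simp only [Finset.mem_filter, Finset.mem_insert]
    constructor
    · rintro ⟨h1, h2⟩
      have := hw w h1 h2
      rcases this.lt_or_eq with h3 | h3
      · exact .inr ⟨h1, h3⟩
      · exact .inl h3
    · rintro (rfl | ⟨h1, h2⟩)
      · exact ⟨hy, hz⟩
      · exact ⟨h1, h2.trans hz⟩
  have hne : (U.filter fun w => y < w ∧ w < y').Nonempty := by
    by_contra hne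
    rw [Finset.not_nonempty_iff_eq_empty, Finset.filter_eq_empty_iff] at hne
    have := hnext y' hlt fun w hw hw' => by
      have := hne hw
      omega
    omega
  obtain ⟨z, hz, hmin⟩ := Finset.exists_min_image _ id hne
  simp only [Finset.mem_filter, id] at hz hmin
  refine ⟨z, hz.1, hz.2.1, hz.2.2, ?_⟩
  have := hnext z hz.2.1 fun w hw hw' => by
    by_contra! hlt
    have := hmin w ⟨hw, hlt, by omega⟩
    omega
  omega

/-! ### Bounds for exchangeable vertices -/

section Forest

variable {V : Type*} {D : Digraph V} {r : V} {p : ℕ → V} {l n : ℕ}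

theorem mem_multiBack {x : ℕ} :
    x ∈ multiBack D p l ↔ x ∈ nonEntries D p l ∧ 2 ≤ (backIn D p l x).card := by
  simp [multiBack]

theorem mem_movable {x : ℕ} :
    x ∈ movable D p l ↔ x ∈ nonEntries D p l ∧ x ∉ siblings D p l ∧ x ∉ multiBack D p l ∧
      (backIn D p l x).Nonempty ∧ ¬ Locked D p l x := by
  simp [movable]

namespace IsIsolatedPath

variable (hP : IsIsolatedPath D r p l) (hred : IsReduced D r)
include hP hred

-- Exchanging a movable vertex creates a forward arc, and several together might close a cycle
-- although none does alone. A separator in `U \ M` keeps a later in-neighbour as parent and breaks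
-- any run through two exchanged vertices.
open Classical in
theorem card_switch_le_of_separated [Fintype V] (hno : ¬ IsYesInstance D r (n + 1))
    (M : Finset ℕ) (hM : M ⊆ multiBack D p l \ siblings D p l ∪ movable D p l)
    (hsep : ∀ y ∈ M, ∀ y' ∈ M, y < y' → y' ∈ movable D p l →
      ∃ z ∈ multiBack D p l \ siblings D p l ∪ movable D p l, y < z ∧ z < y' ∧ z ∉ M) :
    M.card ≤ 2 * n := by
  have hb : ∀ y, ∃ z, y ∈ multiBack D p l → z ∈ backIn D p l y ∧ z ≠ par D p l y := by
    intro y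
    by_cases h : y ∈ multiBack D p l
    · obtain ⟨z, hz⟩ := Finset.exists_mem_ne (mem_multiBack.1 h).2 (par D p l y)
      exact ⟨z, fun _ => hz⟩
    · exact ⟨0, fun h' => absurd h' h⟩
  choose b hb using hb
  have hU : ∀ y ∈ multiBack D p l \ siblings D p l ∪ movable D p l,
      y ∈ nonEntries D p l ∧ y ∉ siblings D p l ∧ (backIn D p l y).Nonempty := by
    intro y hy
    rw [Finset.mem_union, Finset.mem_sdiff] at hy
    rcases hy with ⟨h1, h2⟩ | h
    · have h3 := mem_multiBack.1 h1
      exact ⟨h3.1, h2, Finset.card_pos.1 (by omega)⟩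
    · have h3 := mem_movable.1 h
      exact ⟨h3.1, h3.2.1, h3.2.2.2.1⟩
  have hUF : ∀ y ∈ multiBack D p l \ siblings D p l ∪ movable D p l, ¬ Forced D p l y :=
    fun y hy hF => (hU y hy).2.2.ne_empty hF.2.2
  have hmov : ∀ y ∈ M, y ∉ multiBack D p l → y ∈ movable D p l := by
    intro y hy hy'
    have := hM hy
    rw [Finset.mem_union, Finset.mem_sdiff] at this
    tauto
  -- The new parent is a second later in-neighbour where one exists, and the predecessor otherwise.
  -- Only the latter choice can lengthen forward runs.
  set b' : ℕ → ℕ := fun y => if y ∈ multiBack D p l then b y else y - 1 with hb'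
  refine hP.card_switch_le hred hno M b' (fun y hy => ⟨(hU y (hM hy)).1, (hU y (hM hy)).2.1⟩)
    ?_ ?_
  · intro y hy
    have hyU := hU y (hM hy)
    have hyn := mem_nonEntries.1 hyU.1
    by_cases h : y ∈ multiBack D p l
    · simp only [hb', h, if_true]
      obtain ⟨h1, h2⟩ := hb y h
      exact ⟨(mem_backIn.1 h1).2.2, lt_of_le_of_ne (le_par h1) h2⟩
    · simp only [hb', h, if_false]
      have hpos := hP.pos_of_not_entry hyn.2
      have h1 := hP.adj (y - 1) (by omega)
      rw [show y - 1 + 1 = y by omega] at h1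
      have h2 := (mem_backIn.1 (par_mem_backIn hyU.2.2)).2.1
      exact ⟨h1, by omega⟩
  · intro M' hM' u v huv hv hu hσu hrun
    have hforced : ∀ t, u < t → t ≤ v → t ∉ M' → Forced D p l t := by
      intro t h1 h2 h3
      obtain ⟨h4, h5⟩ := hrun t h1 h2
      simp only [h3, if_false] at h5
      refine ⟨by omega, h4, ?_⟩
      by_contra hne
      have := (mem_backIn.1 (par_mem_backIn (Finset.nonempty_iff_ne_empty.2 hne))).2.1
      omega
    have hmovable : ∀ t, u < t → t ≤ v → t ∈ M' → t ∈ movable D p l := by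
      intro t h1 h2 h3
      obtain ⟨h4, h5⟩ := hrun t h1 h2
      refine hmov t (hM' h3) fun h6 => ?_
      simp only [h3, hb', h6, if_true] at h5
      have := (mem_backIn.1 (hb t h6).1).2.1
      omega
    have hadj : D.Adj (p v) (p u) := by
      by_cases h : u ∈ M'
      · by_cases h' : u ∈ multiBack D p l
        · simp only [h, h', hb', if_true] at hσu
          exact hσu ▸ (mem_backIn.1 (hb u h').1).2.2
        · simp only [h, h', hb', if_true, if_false] at hσu
          omega
      · simp only [h, if_false] at hσu
        exact hσu ▸ (hP.par_spec (huv.trans hv) hu).2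
    have hclash : ∀ y ∈ M', ∀ y' ∈ M', u ≤ y → y < y' → y' ≤ v → False := by
      intro y hy y' hy' h1 h2 h3
      obtain ⟨z, hz, h4, h5, h6⟩ := hsep y (hM' hy) y' (hM' hy') h2
        (hmovable y' (by omega) h3 hy')
      exact hUF z hz (hforced z (by omega) (by omega) fun h => h6 (hM' h))
    -- A closed run contains at most one exchanged vertex. If it contains one, that vertex is
    -- locked; if none, all its vertices after the first are forced.
    by_cases hex : ∃ i ∈ M', u < i ∧ i ≤ v
    · obtain ⟨i, hi, h1, h2⟩ := hex
      have huM : u ∉ M' := fun h => hclash u h i hi le_rfl h1 h2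
      simp only [huM, if_false] at hσu
      refine (mem_movable.1 (hmovable i h1 h2 hi)).2.2.2.2 ⟨u, v, h1, h2, hv, hu, hσu, ?_⟩
      intro t h3 h4 h5
      refine hforced t h3 h4 fun h6 => ?_
      rcases Nat.lt_or_gt_of_ne h5 with h7 | h7
      · exact hclash t h6 i hi h3.le h7 h2
      · exact hclash i hi t h6 h1.le h7 h4
    · push Not at hex
      exact hP.forced_run_false hred huv hadj fun t h1 h2 => hforced t h1 h2 fun h => by
        have := hex t h h1
        omega

open Classical in
theorem card_multiBack_sdiff_le [Fintype V] (hno : ¬ IsYesInstance D r (n + 1)) :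
    (multiBack D p l \ siblings D p l).card ≤ 2 * n := by
  refine hP.card_switch_le_of_separated hred hno _ Finset.subset_union_left ?_
  intro y _ y' hy' _ h
  exact absurd (Finset.mem_sdiff.1 hy').1 (mem_movable.1 h).2.2.1

-- Splitting `U` by parity of rank gives two separated families, each of size at most `2n`.
open Classical in
theorem card_multiBack_union_movable_le [Fintype V] (hno : ¬ IsYesInstance D r (n + 1)) :
    (multiBack D p l \ siblings D p l ∪ movable D p l).card ≤ 4 * n := by
  set U := multiBack D p l \ siblings D p l ∪ movable D p l with hU
  have key : ∀ M : Finset ℕ, M ⊆ U → (∀ y ∈ M, ∀ y' ∈ M,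
      (U.filter (· < y)).card % 2 = (U.filter (· < y')).card % 2) → (∀ y ∈ M, ∀ z ∈ U,
      (U.filter (· < z)).card % 2 ≠ (U.filter (· < y)).card % 2 → z ∉ M) → M.card ≤ 2 * n := by
    intro M hM h1 h2
    refine hP.card_switch_le_of_separated hred hno M hM fun y hy y' hy' hlt _ => ?_
    obtain ⟨z, hz, h3, h4, h5⟩ := exists_rank_separator U (hM hy) hlt (h1 y hy y' hy')
    exact ⟨z, hz, h3, h4, h2 y hy z hz h5⟩
  have h0 := key (U.filter fun y => (U.filter (· < y)).card % 2 = 0) (Finset.filter_subset _ _)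
    (fun y hy y' hy' => by
      rw [(Finset.mem_filter.1 hy).2, (Finset.mem_filter.1 hy').2])
    (fun y hy z _ h hz => by
      rw [(Finset.mem_filter.1 hy).2, (Finset.mem_filter.1 hz).2] at h
      exact h rfl)
  have h1 := key (U.filter fun y => ¬ (U.filter (· < y)).card % 2 = 0) (Finset.filter_subset _ _)
    (fun y hy y' hy' => by
      have h1 := (Finset.mem_filter.1 hy).2
      have h2 := (Finset.mem_filter.1 hy').2
      omega)
    (fun y hy z _ h hz => by
      have h1 := (Finset.mem_filter.1 hy).2
      have h2 := (Finset.mem_filter.1 hz).2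
      omega)
  have h2 := Finset.card_filter_add_card_filter_not (s := U)
    (fun y => (U.filter (· < y)).card % 2 = 0)
  omega

end IsIsolatedPath

end Forest

/-- Following parents until `C` is met labels each vertex with the head of its piece (`hd`) and its
depth there (`dep`). -/
theorem exists_head (l : ℕ) (C : Finset ℕ) (σ ρ : ℕ → ℕ)
    (h : ∀ i < l, i ∉ C → σ i < l ∧ ρ (σ i) < ρ i) :
    ∃ hd dep : ℕ → ℕ, ∀ i < l, hd i ∈ C ∧ (i ∈ C → hd i = i ∧ dep i = 0) ∧
      (i ∉ C → hd i = hd (σ i) ∧ dep i = dep (σ i) + 1) := by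
  classical
  have hex : ∀ m, ∀ i < l, ρ i = m → ∃ k, σ^[k] i ∈ C := by
    intro m
    induction m using Nat.strong_induction_on with
    | _ m ih =>
      intro i hi hm
      by_cases hC : i ∈ C
      · exact ⟨0, hC⟩
      · obtain ⟨h1, h2⟩ := h i hi hC
        obtain ⟨k, hk⟩ := ih _ (hm ▸ h2) _ h1 rfl
        exact ⟨k + 1, hk⟩
  let dep : ℕ → ℕ := fun i => if h : ∃ k, σ^[k] i ∈ C then Nat.find h else 0
  refine ⟨fun i => σ^[dep i] i, dep, fun i hi => ?_⟩
  have h1 := hex _ i hi rfl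
  have hdep : dep i = Nat.find h1 := dif_pos h1
  refine ⟨?_, fun hC => ?_, fun hC => ?_⟩
  · simp only [hdep]
    exact Nat.find_spec h1
  · have : dep i = 0 := by
      rw [hdep, Nat.find_eq_zero]
      exact hC
    simp only [this]
    exact ⟨rfl, trivial⟩
  · have h2 := hex _ (σ i) (h i hi hC).1 rfl
    have hdep' : dep (σ i) = Nat.find h2 := dif_pos h2
    have h3 : dep i = dep (σ i) + 1 := by
      rw [hdep, hdep']
      exact Nat.find_comp_succ h1 h2 hC
    refine ⟨?_, h3⟩
    simp only [h3, Function.iterate_succ_apply]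

/-! ### Unary pieces, targets and ports -/

section Ports

/-- The vertices of the canonical forest at which it is cut into unary paths. -/
noncomputable def cuts {V : Type*} (D : Digraph V) (p : ℕ → V) (l : ℕ) : Finset ℕ :=
  (Finset.range l \ nonEntries D p l) ∪ siblings D p l ∪
    (multiBack D p l \ siblings D p l ∪ movable D p l)

open Classical in
/-- The targets of those arcs from the path that are neither arcs of the canonical forest nor
arcs of the path: the outside, the entries, and the vertices with several later in-neighbours. -/
noncomputable def targets {V : Type*} [Fintype V] (D : Digraph V) (p : ℕ → V) (l : ℕ) : Finset V :=
  ((Finset.range l \ nonEntries D p l) ∪ multiBack D p l).image p ∪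
    Finset.univ.filter fun x => Outside p l x ∧ ∃ i < l, D.Adj (p i) x

open Classical in
/-- The vertices of the path with an arc to a target. -/
noncomputable def ports {V : Type*} [Fintype V] (D : Digraph V) (p : ℕ → V) (l : ℕ) : Finset ℕ :=
  (Finset.range l).filter fun i => ∃ w ∈ targets D p l, D.Adj (p i) w

variable {V : Type*} {D : Digraph V} {r : V} {p : ℕ → V} {l n : ℕ}

theorem of_notMem_cuts {i : ℕ} (hi : i < l) (h : i ∉ cuts D p l) :
    i ∈ nonEntries D p l ∧ i ∉ siblings D p l ∧ i ∉ multiBack D p l ∧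
      ((backIn D p l i).Nonempty → Locked D p l i) := by
  simp only [cuts, Finset.mem_union, Finset.mem_sdiff, Finset.mem_range, mem_movable] at h
  tauto

theorem eq_par_of_mem_backIn {i j : ℕ} (hi : i ∈ nonEntries D p l) (h : i ∉ multiBack D p l)
    (hj : j ∈ backIn D p l i) : j = par D p l i := by
  by_contra hne
  exact h (mem_multiBack.2 ⟨hi, Finset.one_lt_card.2 ⟨j, hj, _, par_mem_backIn ⟨j, hj⟩, hne⟩⟩)

theorem par_of_forced {i : ℕ} (h : Forced D p l i) : par D p l i = i - 1 := par_of_empty h.2.2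

namespace IsIsolatedPath

variable (hP : IsIsolatedPath D r p l) (hred : IsReduced D r)
include hP hred

theorem card_cuts_le [Fintype V] (hno : ¬ IsYesInstance D r (n + 1)) :
    (cuts D p l).card ≤ 6 * n := by
  have h1 := hP.card_siblings_le hred hno
  have h2 : (multiBack D p l \ siblings D p l ∪ movable D p l).card ≤ 4 * n := by
    convert hP.card_multiBack_union_movable_le hred hno
  have h3 := Finset.card_union_le (Finset.range l \ nonEntries D p l ∪ siblings D p l)
    (multiBack D p l \ siblings D p l ∪ movable D p l)
  have h4 := Finset.card_union_le (Finset.range l \ nonEntries D p l) (siblings D p l)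
  rw [cuts]
  omega

theorem card_targets_le [Fintype V] (hno : ¬ IsYesInstance D r (n + 1)) :
    (targets D p l).card ≤ 7 * n := by
  classical
  have h1 := hP.card_siblings_le hred hno
  have h2 : (multiBack D p l \ siblings D p l).card ≤ 2 * n := by
    convert hP.card_multiBack_sdiff_le hred hno
  have h3 := hP.card_exits_le hred hno
  have h4 := Finset.card_le_card_sdiff_add_card (s := multiBack D p l) (t := siblings D p l)
  rw [targets]
  refine (Finset.card_union_le _ _).trans ?_
  refine (Nat.add_le_add (Finset.card_image_le.trans (Finset.card_union_le _ _)) h3).trans ?_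
  omega

/-- Forced vertices are never consecutive. Hence the run from `u` to `v` consists of two adjacent
blocks of one or two vertices, the upper one starting at `i`. -/
theorem locked_cases {i : ℕ} (h : Locked D p l i) :
    ∃ u v, v < l ∧ ¬ Entry D p l u ∧ par D p l u = v ∧
      (u + 1 = i ∨ u + 2 = i ∧ Forced D p l (u + 1)) ∧
      (v = i ∨ v = i + 1 ∧ Forced D p l (i + 1)) := by
  obtain ⟨u, v, h1, h2, h3, h4, h5, h6⟩ := h
  refine ⟨u, v, h3, h4, h5, ?_, ?_⟩
  · rcases Nat.lt_or_ge (u + 1) i with h7 | h7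
    · have h8 := h6 (u + 1) (by omega) (by omega) (by omega)
      rcases Nat.lt_or_ge (u + 2) i with h9 | h9
      · exact absurd (h6 (u + 2) (by omega) (by omega) (by omega)) (hP.not_forced_succ hred h8)
      · exact .inr ⟨by omega, h8⟩
    · exact .inl (by omega)
  · rcases Nat.lt_or_ge i v with h7 | h7
    · have h8 := h6 (i + 1) (by omega) (by omega) (by omega)
      rcases Nat.lt_or_ge (i + 1) v with h9 | h9
      · exact absurd (h6 (i + 2) (by omega) (by omega) (by omega)) (hP.not_forced_succ hred h8)
      · exact .inr ⟨by omega, h8⟩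
    · exact .inl (by omega)

section Fibre

variable {hd dep : ℕ → ℕ} (H : ∀ i < l, hd i ∈ cuts D p l ∧ (i ∈ cuts D p l → hd i = i ∧ dep i = 0) ∧
      (i ∉ cuts D p l → hd i = hd (par D p l i) ∧ dep i = dep (par D p l i) + 1))
include H

-- Vertices that are not cuts have no siblings, so a piece contains at most one vertex of each
-- depth.
omit hred in
theorem eq_of_hd_dep : ∀ m, ∀ i < l, ∀ j < l, hd i = hd j → dep i = m → dep j = m → i = j := by
  intro m
  induction m with
  | zero =>
    intro i hi j hj h h1 h2
    have h3 : ∀ i < l, dep i = 0 → hd i = i := by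
      intro i hi h
      by_cases hC : i ∈ cuts D p l
      · exact ((H i hi).2.1 hC).1
      · have := ((H i hi).2.2 hC).2
        omega
    rw [← h3 i hi h1, ← h3 j hj h2, h]
  | succ m ih =>
    intro i hi j hj h h1 h2
    have h3 : ∀ i < l, dep i = m + 1 → i ∉ cuts D p l := by
      intro i hi h hC
      have := ((H i hi).2.1 hC).2
      omega
    have hiC := h3 i hi h1
    have hjC := h3 j hj h2
    have hi' := of_notMem_cuts hi hiC
    have hj' := of_notMem_cuts hj hjC
    have hi2 := (H i hi).2.2 hiC
    have hj2 := (H j hj).2.2 hjC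
    refine eq_of_par_eq hj'.1 hi'.1 hj'.2.1 (ih _ (hP.par_spec hi (mem_nonEntries.1 hi'.1).2).1 _
      (hP.par_spec hj (mem_nonEntries.1 hj'.1).2).1 ?_ ?_ ?_)
    · rw [← hi2.1, ← hj2.1, h]
    · omega
    · omega

omit hred in
theorem exists_hd_dep {z : ℕ} (hz : z < l) : ∀ k, k ≤ dep z →
    ∃ w < l, hd w = hd z ∧ dep w + k = dep z := by
  intro k
  induction k with
  | zero => exact fun _ => ⟨z, hz, rfl, rfl⟩
  | succ k ih =>
    intro hk
    obtain ⟨w, hw, h1, h2⟩ := ih (by omega)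
    have hC : w ∉ cuts D p l := fun hC => by
      have := ((H w hw).2.1 hC).2
      omega
    have h3 := (H w hw).2.2 hC
    exact ⟨par D p l w, (hP.par_spec hw (mem_nonEntries.1 (of_notMem_cuts hw hC).1).2).1,
      by rw [← h3.1, h1], by omega⟩

-- The piece continues from `w` down to `z`, and its next vertex has no sibling. It is therefore the
-- only child of `w`.
omit hred in
theorem hd_dep_of_par {z w c : ℕ} (hz : z < l) (hw : w < l) (hwz : hd w = hd z)
    (hlt : dep w < dep z) (hc : c < l) (hcE : ¬ Entry D p l c) (hcw : par D p l c = w) :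
    hd c = hd z ∧ dep c = dep w + 1 := by
  obtain ⟨x, hx, h1, h2⟩ := hP.exists_hd_dep H hz (dep z - (dep w + 1)) (by omega)
  have hC : x ∉ cuts D p l := fun hC => by
    have := ((H x hx).2.1 hC).2
    omega
  have h3 := (H x hx).2.2 hC
  have h4 := of_notMem_cuts hx hC
  have h5 : par D p l x = w := hP.eq_of_hd_dep H _ _ (hP.par_spec hx (mem_nonEntries.1 h4.1).2).1 _
    hw (by rw [← h3.1, h1, hwz]) rfl (by omega)
  obtain rfl : c = x := eq_of_par_eq h4.1 (mem_nonEntries.2 ⟨hc, hcE⟩) h4.2.1 (by rw [hcw, h5])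
  exact ⟨h1, by omega⟩

/-- Three vertices on a unary piece of the canonical forest have no common out-neighbour. -/
theorem no_common_outNeighbor {x y z : ℕ} (hx : x < l) (hy : y < l) (hz : z < l)
    (hxz : hd x = hd z) (hyz : hd y = hd z) (hxy : dep x < dep y) (hlt : dep y < dep z) {w : V}
    (hxw : D.Adj (p x) w) (hyw : D.Adj (p y) w) (hzw : D.Adj (p z) w) : False := by
  classical
  have hpr : ∀ i < l, p i ≠ r := fun i hi h => hP.root i hi h.symm
  -- In this case `p y` alone disconnects `p z`, and the arc from `p z` to `w` is already avoidable.
  have hzy : ¬ (Forced D p l z ∧ z = y + 1) := by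
    rintro ⟨hF, h⟩
    refine hred.avoidable_arc ⟨{p y}, p z, w, by simp, ?_, ?_, hzw, by simpa using hyw⟩
    · rw [Finset.mem_singleton]
      intro h'
      have := hP.inj z hz y hy h'
      omega
    · refine setDisconnects_of_closed (C := {p z}) (fun h => hpr z hz h.symm) rfl ?_
      rintro u v huv rfl
      right
      rw [hP.eq_of_adj_forced hred hF huv, h]
      simp
  -- The set to be cut off is the stretch of the piece between `x` and `z`, with two corrections. If
  -- `z` is forced, its predecessor is dropped, since the path can enter it from below `z`. If `z +
  -- 1` is forced, it is added, since it is entered only from `z` but may itself lead into the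
  -- stretch.
  let K : ℕ → Prop := fun i => i < l ∧ hd i = hd z ∧ dep x < dep i ∧ dep i < dep z ∧
    ¬ (Forced D p l z ∧ z = i + 1)
  refine hred.avoidable_arc ⟨{p x, p z}, p y, w, Finset.card_le_two, ?_, ?_, hyw, ?_⟩
  · simp only [Finset.mem_insert, Finset.mem_singleton, not_or]
    constructor
    · intro h
      obtain rfl := hP.inj y hy x hx h
      exact lt_irrefl _ hxy
    · intro h
      obtain rfl := hP.inj y hy z hz h
      exact lt_irrefl _ hlt
  · refine setDisconnects_of_closed (C := {v | ∃ i, v = p i ∧ (K i ∨ i = z + 1 ∧ Forced D p l i)})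
      ?_ ⟨y, rfl, .inl ⟨hy, hyz, hxy, hlt, hzy⟩⟩ ?_
    · rintro ⟨i, h, ⟨hi, -⟩ | ⟨-, hi, -⟩⟩ <;> exact hpr i hi h.symm
    rintro u v huv ⟨i, rfl, ⟨hi, hiz, h1, h2, h3⟩ | ⟨rfl, hF⟩⟩
    swap
    · right
      rw [hP.eq_of_adj_forced hred hF huv]
      simp
    have hiC : i ∉ cuts D p l := fun hC => by
      have := ((H i hi).2.1 hC).2
      omega
    obtain ⟨hin, hsib, hmul, hlock⟩ := of_notMem_cuts hi hiC
    have hiE := (mem_nonEntries.1 hin).2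
    have hiH := (H i hi).2.2 hiC
    have hou : ¬ Outside p l u := fun ho => hiE ⟨u, ho, huv⟩
    obtain ⟨j, hj, rfl⟩ := not_outside.1 hou
    have hji := hP.fwd j hj i hi huv
    have hne : j ≠ i := by
      rintro rfl
      exact hred.not_adj_self _ huv
    -- membership in the cut or the closed set, from the position in the fibre
    have hmem : hd j = hd z → dep x ≤ dep j → dep j ≤ dep z → ¬ (Forced D p l z ∧ z = j + 1) →
        p j ∈ {v | ∃ i, v = p i ∧ (K i ∨ i = z + 1 ∧ Forced D p l i)} ∨
          p j ∈ ((({p x, p z} : Finset V)) : Set V) := by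
      intro h4 h5 h6 h7
      rcases h5.eq_or_lt with h8 | h8
      · right
        rw [hP.eq_of_hd_dep H _ j hj x hx (h4.trans hxz.symm) rfl h8]
        simp
      rcases h6.eq_or_lt with h9 | h9
      · right
        rw [hP.eq_of_hd_dep H _ j hj z hz h4 rfl h9.symm]
        simp
      · exact .inl ⟨j, rfl, .inl ⟨hj, h4, h8, h9, h7⟩⟩
    by_cases hpar : j = par D p l i
    · rw [← hpar] at hiH
      refine hmem (hiH.1.symm.trans hiz) (by omega) (by omega) ?_
      rintro ⟨hF, h⟩
      have h4 : par D p l z = par D p l i := by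
        rw [par_of_forced hF, ← hpar]
        omega
      have h5 := eq_of_par_eq hin (mem_nonEntries.2 ⟨hz, hF.2.1⟩) hsib h4
      rw [h5] at h2
      omega
    · have hlt' : j < i := by
        by_contra! hge
        exact hpar (eq_par_of_mem_backIn hin hmul (mem_backIn.2 ⟨hj, by omega, huv⟩))
      obtain rfl : i = j + 1 := by omega
      -- The arc is the path arc into `i = j + 1` and not its parent arc. Hence `i` is locked, and
      -- `j` lies in the block just below `i` in the piece, at most three parent steps down.
      have hback : (backIn D p l (j + 1)).Nonempty := by
        rw [Finset.nonempty_iff_ne_empty]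
        intro h
        rw [par_of_empty h] at hpar
        exact hpar rfl
      have hzj : ¬ (Forced D p l z ∧ z = j + 1) := by
        rintro ⟨-, rfl⟩
        omega
      obtain ⟨a, b, hb, haE, hab, ha, hbi⟩ := hP.locked_cases hred (hlock hback)
      have hbz : hd b = hd z ∧ dep x ≤ dep b ∧ dep b < dep z := by
        rcases hbi with rfl | ⟨rfl, hF⟩
        · exact ⟨hiz, h1.le, h2⟩
        · obtain ⟨h4, h5⟩ := hP.hd_dep_of_par H hz hi hiz h2 hF.1 hF.2.1 (par_of_forced hF)
          refine ⟨h4, by omega, lt_of_le_of_ne (by omega) fun h6 => ?_⟩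
          obtain rfl := hP.eq_of_hd_dep H _ _ hb z hz h4 rfl h6.symm
          exact h3 ⟨hF, rfl⟩
      have hal : a < l := by omega
      obtain ⟨h4, h5⟩ := hP.hd_dep_of_par H hz hb hbz.1 hbz.2.2 hal haE hab
      rcases ha with ha | ⟨ha, hF⟩
      · obtain rfl : a = j := by omega
        exact hmem h4 (by omega) (by omega) hzj
      · obtain rfl : j = a + 1 := by omega
        rcases (show dep a ≤ dep z by omega).eq_or_lt with h6 | h6
        · obtain rfl := hP.eq_of_hd_dep H _ a hal z hz h4 rfl h6.symm
          exact .inl ⟨a + 1, rfl, .inr ⟨rfl, hF⟩⟩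
        · obtain ⟨h7, h8⟩ := hP.hd_dep_of_par H hz hal h4 h6 hF.1 hF.2.1 (par_of_forced hF)
          exact hmem h7 (by omega) (by omega) hzj
  · simp only [Finset.mem_insert, Finset.mem_singleton, forall_eq_or_imp, forall_eq]
    exact ⟨hxw, hzw⟩

end Fibre

/-- Send each port to its piece and one of its targets. Fibres have at most two elements, because
depths within a piece are distinct and three would make the Avoidable Arc rule apply. -/
theorem card_ports_le [Fintype V] (hno : ¬ IsYesInstance D r (n + 1)) :
    (ports D p l).card ≤ 84 * n ^ 2 := by
  classical
  obtain ⟨ρ, hρ⟩ := exists_rank (N := fun i => ¬ Entry D p l i) (σ := par D p l) (l := l)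
    (not_not.2 hP.entry) (fun i hi hE => by
      obtain ⟨h1, h2⟩ := hP.par_spec hi hE
      refine ⟨h1, hP.fwd _ h1 _ hi h2, fun h => ?_⟩
      rw [h] at h2
      exact hred.not_adj_self _ h2) (hP.par_noRun hred)
  obtain ⟨hd, dep, H⟩ := exists_head l (cuts D p l) (par D p l) ρ (fun i hi hC => by
    have hE := (mem_nonEntries.1 (of_notMem_cuts hi hC).1).2
    exact ⟨(hP.par_spec hi hE).1, hρ i hi hE⟩)
  have hw : ∀ i, ∃ w, i ∈ ports D p l → w ∈ targets D p l ∧ D.Adj (p i) w := by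
    intro i
    by_cases h : i ∈ ports D p l
    · obtain ⟨w, hw⟩ := (Finset.mem_filter.1 h).2
      exact ⟨w, fun _ => hw⟩
    · exact ⟨r, fun h' => absurd h' h⟩
  choose w hw using hw
  have hl : ∀ i ∈ ports D p l, i < l := fun i hi => Finset.mem_range.1 (Finset.mem_filter.1 hi).1
  have hfib : ∀ b ∈ cuts D p l ×ˢ targets D p l,
      ((ports D p l).filter fun i => (hd i, w i) = b).card ≤ 2 := by
    rintro ⟨c, v⟩ -
    by_contra! hlt
    obtain ⟨x, y, z, hx, hy, hz, hxy, hxz, hyz⟩ := Finset.two_lt_card_iff.1 hlt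
    simp only [Finset.mem_filter, Prod.mk.injEq] at hx hy hz
    have key : ∀ x y, (x ∈ ports D p l ∧ hd x = c ∧ w x = v) →
        (y ∈ ports D p l ∧ hd y = c ∧ w y = v) → x ≠ y → dep x ≠ dep y := by
      intro x y hx hy hne h
      exact hne (hP.eq_of_hd_dep H _ x (hl x hx.1) y (hl y hy.1) (hx.2.1.trans hy.2.1.symm) rfl
        h.symm)
    have main : ∀ x y z, (x ∈ ports D p l ∧ hd x = c ∧ w x = v) →
        (y ∈ ports D p l ∧ hd y = c ∧ w y = v) → (z ∈ ports D p l ∧ hd z = c ∧ w z = v) →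
        dep x < dep y → dep y < dep z → False := by
      intro x y z hx hy hz h1 h2
      exact hP.no_common_outNeighbor hred H (hl x hx.1) (hl y hy.1) (hl z hz.1)
        (hx.2.1.trans hz.2.1.symm) (hy.2.1.trans hz.2.1.symm) h1 h2
        (hx.2.2 ▸ (hw x hx.1).2) (hy.2.2 ▸ (hw y hy.1).2) (hz.2.2 ▸ (hw z hz.1).2)
    have h1 := key x y hx hy hxy
    have h2 := key x z hx hz hxz
    have h3 := key y z hy hz hyz
    rcases Nat.lt_or_gt_of_ne h1 with h1 | h1 <;> rcases Nat.lt_or_gt_of_ne h2 with h2 | h2 <;>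
      rcases Nat.lt_or_gt_of_ne h3 with h3 | h3
    · exact main x y z hx hy hz h1 h3
    · exact main x z y hx hz hy h2 h3
    · omega
    · exact main z x y hz hx hy h2 h1
    · exact main y x z hy hx hz h1 h2
    · omega
    · exact main y z x hy hz hx h3 h2
    · exact main z y x hz hy hx h3 h1
  have h1 := Finset.card_le_mul_card_image_of_maps_to (s := ports D p l)
    (t := cuts D p l ×ˢ targets D p l) (f := fun i => (hd i, w i))
    (fun i hi => Finset.mem_product.2 ⟨(H i (hl i hi)).1, (hw i hi).1⟩) 2 hfib
  rw [Finset.card_product] at h1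
  have h2 := Nat.mul_le_mul (hP.card_cuts_le hred hno) (hP.card_targets_le hred hno)
  nlinarith

end IsIsolatedPath

end Ports

/-! ### Paths as lists, and uniqueness of out-branchings -/

section ListPath

variable {V : Type*} {D : Digraph V} {g : ℕ → V} {m : ℕ}

theorem arcOf_map_range {u v : V} :
    ArcOf ((List.range m).map g) u v ↔ ∃ i, i + 1 < m ∧ u = g i ∧ v = g (i + 1) := by
  constructor
  · rintro ⟨s, t, h⟩
    have hlen := congrArg List.length h
    simp at hlen
    have h1 : ((List.range m).map g)[s.length]? = some u := by simp [← h]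
    have h2 : ((List.range m).map g)[s.length + 1]? = some v := by simp [← h]
    rw [List.getElem?_map, List.getElem?_range (by omega)] at h1 h2
    simp only [Option.map_some, Option.some.injEq] at h1 h2
    exact ⟨s.length, by omega, h1.symm, h2.symm⟩
  · rintro ⟨i, hi, rfl, rfl⟩
    refine ⟨((List.range m).map g).take i, ((List.range m).map g).drop (i + 2), ?_⟩
    have h1 : ((List.range m).map g).drop i
        = g i :: g (i + 1) :: ((List.range m).map g).drop (i + 2) := by
      rw [List.drop_eq_getElem_cons (by simp; omega), List.drop_eq_getElem_cons (by simp; omega)]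
      simp
    rw [List.append_assoc]
    simp only [List.cons_append, List.nil_append]
    rw [← h1, List.take_append_drop]

theorem isPath_map_range (hm : 0 < m) (hinj : ∀ i < m, ∀ j < m, g i = g j → i = j)
    (hadj : ∀ i, i + 1 < m → D.Adj (g i) (g (i + 1))) :
    IsPath D (g 0) (g (m - 1)) ((List.range m).map g) := by
  refine ⟨?_, ?_, ?_, ?_⟩
  · rw [List.isChain_iff_forall_rel_of_append_cons_cons]
    intro a b l₁ l₂ h
    obtain ⟨i, hi, rfl, rfl⟩ := arcOf_map_range.1 (⟨l₁, l₂, by simp [h]⟩ :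
      ArcOf ((List.range m).map g) a b)
    exact hadj i hi
  · refine List.Nodup.map_on ?_ List.nodup_range
    intro x hx y hy h
    exact hinj x (List.mem_range.1 hx) y (List.mem_range.1 hy) h
  · obtain ⟨k, rfl⟩ : ∃ k, m = k + 1 := ⟨m - 1, by omega⟩
    simp [List.range_succ_eq_map]
  · obtain ⟨k, rfl⟩ : ∃ k, m = k + 1 := ⟨m - 1, by omega⟩
    simp [List.range_succ]

/-- A path without forward jumps is the unique out-branching, rooted at its start, of the
subdigraph induced by its vertices. -/
theorem isOutBranchingOn_iff_of_noJump (hm : 0 < m) (hinj : ∀ i < m, ∀ j < m, g i = g j → i = j)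
    (hadj : ∀ i, i + 1 < m → D.Adj (g i) (g (i + 1)))
    (hfwd : ∀ i < m, ∀ j < m, D.Adj (g i) (g j) → j ≤ i + 1) (X : Set V)
    (hX : ∀ x, x ∈ X ↔ ∃ i < m, x = g i) (T : Digraph V) :
    IsOutBranchingOn D X (g 0) T ↔ T = pathDigraph ((List.range m).map g) := by
  constructor
  · intro hT
    -- Without forward jumps, reaching `g j` from `g 0` inside `X` requires every path arc up to `g
    -- j`.
    have key : ∀ v, ReflTransGen T.Adj (g 0) v → ∀ j < m, v = g j → ∀ i < j,
        T.Adj (g i) (g (i + 1)) := by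
      intro v hv
      induction hv with
      | refl =>
        intro j hj h i hi
        have := hinj 0 hm j hj h
        omega
      | @tail u v _ huv ih =>
        intro j hj h i hi
        obtain ⟨h1, h2, h3⟩ := hT.arcs _ _ huv
        obtain ⟨k, hk, rfl⟩ := (hX u).1 h2
        subst h
        have h4 := hfwd k hk j hj h1
        rcases Nat.lt_or_ge i k with h5 | h5
        · exact ih k hk rfl i h5
        · obtain rfl : i = k := by omega
          obtain rfl : j = i + 1 := by omega
          exact huv
    have hstep : ∀ i, i + 1 < m → T.Adj (g i) (g (i + 1)) := fun i hi =>
      key _ (hT.reach _ ((hX _).2 ⟨i + 1, hi, rfl⟩)) (i + 1) hi rfl i (Nat.lt_succ_self i)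
    ext u v
    change T.Adj u v ↔ ArcOf _ u v
    rw [arcOf_map_range]
    constructor
    · intro huv
      obtain ⟨h1, h2, h3⟩ := hT.arcs _ _ huv
      obtain ⟨j, hj, rfl⟩ := (hX v).1 h3
      rcases j with _ | j
      · exact absurd huv (hT.root_in u)
      · refine ⟨j, hj, ?_, rfl⟩
        refine (hT.parent _ h3 fun h => ?_).unique huv (hstep j hj)
        have := hinj _ hj 0 hm h
        omega
    · rintro ⟨i, hi, rfl, rfl⟩
      exact hstep i hi
  · rintro rfl
    have hA : ∀ u v, (pathDigraph ((List.range m).map g)).Adj u v ↔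
        ∃ i, i + 1 < m ∧ u = g i ∧ v = g (i + 1) := fun u v => arcOf_map_range
    refine ⟨(hX _).2 ⟨0, hm, rfl⟩, ?_, ?_, ?_, ?_⟩
    · intro u v h
      obtain ⟨i, hi, rfl, rfl⟩ := (hA u v).1 h
      exact ⟨hadj i hi, (hX _).2 ⟨i, by omega, rfl⟩, (hX _).2 ⟨i + 1, hi, rfl⟩⟩
    · intro u h
      obtain ⟨i, hi, -, h2⟩ := (hA u _).1 h
      have := hinj 0 hm (i + 1) hi h2
      omega
    · intro v hv hne
      obtain ⟨j, hj, rfl⟩ := (hX v).1 hv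
      rcases j with _ | j
      · exact absurd rfl hne
      · refine ⟨g j, (hA _ _).2 ⟨j, hj, rfl, rfl⟩, fun y hy => ?_⟩
        obtain ⟨i, hi, rfl, h2⟩ := (hA y _).1 hy
        have := hinj (j + 1) hj (i + 1) hi h2
        rw [show i = j by omega]
    · intro v hv
      obtain ⟨j, hj, rfl⟩ := (hX v).1 hv
      clear hv
      induction j with
      | zero => exact .refl
      | succ j ih => exact (ih (by omega)).tail ((hA _ _).2 ⟨j, hj, rfl, rfl⟩)

end ListPath

/-! ### Unmarked windows are two directional paths -/

section Window

/-- The vertices of the path at which the structure of the canonical forest is irregular. -/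
noncomputable def marks {V : Type*} [Fintype V] (D : Digraph V) (p : ℕ → V) (l : ℕ) : Finset ℕ :=
  cuts D p l ∪ branching D p l ∪ forestLeaves D p l ∪ ports D p l ∪ {l - 1}

open Classical in
/-- The involution exchanging each forced vertex with its predecessor. -/
noncomputable def blockSwap {V : Type*} (D : Digraph V) (p : ℕ → V) (l i : ℕ) : ℕ :=
  if Forced D p l (i + 1) then i + 1 else if Forced D p l i then i - 1 else i

variable {V : Type*} [Fintype V] {D : Digraph V} {r : V} {p : ℕ → V} {l n : ℕ}

theorem outside_mem_targets {i : ℕ} {w : V} (hi : i < l) (hw : Outside p l w)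
    (h : D.Adj (p i) w) : w ∈ targets D p l := by
  classical
  simp only [targets, Finset.mem_union, Finset.mem_filter, Finset.mem_univ, true_and]
  exact .inr ⟨hw, i, hi, h⟩

theorem mem_targets_of_index {j : ℕ} (hj : j < l)
    (h : Entry D p l j ∨ j ∈ multiBack D p l) : p j ∈ targets D p l := by
  classical
  simp only [targets, Finset.mem_union]
  refine .inl (Finset.mem_image_of_mem _ ?_)
  rw [Finset.mem_union]
  refine h.imp_left fun h => ?_
  rw [Finset.mem_sdiff, mem_nonEntries]
  exact ⟨Finset.mem_range.2 hj, fun h' => h'.2 h⟩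

theorem of_notMem_marks {i : ℕ} (hi : i < l) (h : i ∉ marks D p l) :
    i ∈ nonEntries D p l ∧ i ∉ siblings D p l ∧ i ∉ multiBack D p l ∧
      ((backIn D p l i).Nonempty → Locked D p l i) ∧
      (∀ w w', w ∈ nonEntries D p l → w' ∈ nonEntries D p l → par D p l w = i →
        par D p l w' = i → w = w') ∧
      (∃ w ∈ nonEntries D p l, par D p l w = i) ∧
      (∀ w ∈ targets D p l, ¬ D.Adj (p i) w) ∧ i + 1 < l := by
  classical
  simp only [marks, Finset.mem_union, Finset.mem_singleton, not_or] at h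
  obtain ⟨⟨⟨⟨h1, h2⟩, h3⟩, h4⟩, h5⟩ := h
  obtain ⟨h6, h7, h8, h9⟩ := of_notMem_cuts hi h1
  refine ⟨h6, h7, h8, h9, ?_, ?_, ?_, by omega⟩
  · intro w w' hw hw' h10 h11
    by_contra hne
    refine h2 (Finset.mem_filter.2 ⟨Finset.mem_range.2 hi, Finset.one_lt_card.2 ⟨w, ?_, w', ?_, hne⟩⟩)
    · exact mem_kids.2 ⟨mem_nonEntries.1 hw, h10⟩
    · exact mem_kids.2 ⟨mem_nonEntries.1 hw', h11⟩
  · by_contra! hne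
    exact h3 (Finset.mem_filter.2 ⟨Finset.mem_range.2 hi, hne⟩)
  · intro w hw hadj
    exact h4 (Finset.mem_filter.2 ⟨Finset.mem_range.2 hi, w, hw, hadj⟩)

namespace IsIsolatedPath

variable (hP : IsIsolatedPath D r p l) (hred : IsReduced D r)
include hP hred

/-- A stretch of seven or eight unmarked vertices of the path, made up of whole blocks, is a
two directional path. -/
theorem twoDirectionalPathRuleApplies {a b : ℕ} (hab : b = a + 6 ∨ b = a + 7)
    (hbl : b < l) (hmark : ∀ i, a ≤ i → i ≤ b → i ∉ marks D p l)
    (haF : ¬ Forced D p l a) (hbF : ¬ Forced D p l (b + 1)) :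
    TwoDirectionalPathRuleApplies D := by
  classical
  set τ := blockSwap D p l with hτ
  have info := fun i h1 h2 => of_notMem_marks (lt_of_le_of_lt h2 hbl) (hmark i h1 h2)
  have hsucc : ∀ i, Forced D p l i → ¬ Forced D p l (i + 1) := fun i => hP.not_forced_succ hred
  have hpred : ∀ i, ¬ (Forced D p l (i + 1) ∧ D.Adj (p (i + 1)) (p i)) := fun i h =>
    hP.not_adj_pred_of_forced hred h.1 h.2
  -- the three cases for the involution
  have hcase : ∀ i, (Forced D p l (i + 1) ∧ τ i = i + 1) ∨
      (¬ Forced D p l (i + 1) ∧ Forced D p l i ∧ τ i + 1 = i) ∨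
      (¬ Forced D p l (i + 1) ∧ ¬ Forced D p l i ∧ τ i = i) := by
    intro i
    simp only [hτ, blockSwap]
    split_ifs with h1 h2
    · exact .inl ⟨h1, rfl⟩
    · have := hP.pos_of_not_entry h2.2.1
      exact .inr (.inl ⟨h1, h2, by omega⟩)
    · exact .inr (.inr ⟨h1, h2, rfl⟩)
  have hττ : ∀ i, τ (τ i) = i := by
    intro i
    rcases hcase i with ⟨h1, h2⟩ | ⟨h1, h2, h3⟩ | ⟨h1, h2, h3⟩
    · rw [h2]
      rcases hcase (i + 1) with ⟨h4, h5⟩ | ⟨h4, h5, h6⟩ | ⟨h4, h5, h6⟩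
      · exact absurd h4 (hsucc _ h1)
      · omega
      · exact absurd h1 h5
    · rcases hcase (τ i) with ⟨h4, h5⟩ | ⟨h4, h5, h6⟩ | ⟨h4, h5, h6⟩
      · omega
      · rw [h3] at h4; exact absurd h2 h4
      · rw [h3] at h4; exact absurd h2 h4
    · rw [h3, h3]
  have hwin : ∀ i, a ≤ i → i ≤ b → a ≤ τ i ∧ τ i ≤ b := by
    intro i h1 h2
    rcases hcase i with ⟨h3, h4⟩ | ⟨h3, h4, h5⟩ | ⟨h3, h4, h5⟩
    · rcases h2.eq_or_lt with rfl | h2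
      · exact absurd h3 hbF
      · omega
    · rcases h1.eq_or_lt with rfl | h1
      · exact absurd h4 haF
      · omega
    · omega
  have hnear : ∀ i, i ≤ τ i + 1 ∧ τ i ≤ i + 1 := by
    intro i
    rcases hcase i with ⟨h3, h4⟩ | ⟨h3, h4, h5⟩ | ⟨h3, h4, h5⟩ <;> omega
  -- the canonical parents inside the window
  have hpar : ∀ i, a ≤ i → i + 1 ≤ b → ¬ Forced D p l (i + 1) →
      par D p l (τ i) = τ (i + 1) := by
    intro i h1 h2 h3
    obtain ⟨hn, hs, hm, hlock, huniq, -⟩ := info (i + 1) (by omega) h2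
    have hne : (backIn D p l (i + 1)).Nonempty := by
      rw [Finset.nonempty_iff_ne_empty]
      exact fun h => h3 ⟨by omega, (mem_nonEntries.1 hn).2, h⟩
    obtain ⟨u, v, hv, hu, huv, hui, hvi⟩ := hP.locked_cases hred (hlock hne)
    have hul : u ∈ nonEntries D p l := mem_nonEntries.2 ⟨by omega, hu⟩
    have hτi : τ i = u := by
      rcases hcase i with ⟨h4, h5⟩ | ⟨h4, h5, h6⟩ | ⟨h4, h5, h6⟩
      · exact absurd h4 h3
      · rcases hui with h7 | ⟨h7, h8⟩
        · obtain rfl : u = i := by omega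
          have := par_of_forced h5
          omega
        · omega
      · rcases hui with h7 | ⟨h7, h8⟩
        · omega
        · obtain rfl : i = u + 1 := by omega
          exact absurd h8 h5
    have hτi' : τ (i + 1) = v := by
      rcases hcase (i + 1) with ⟨h4, h5⟩ | ⟨h4, h5, h6⟩ | ⟨h4, h5, h6⟩
      · rcases hvi with rfl | ⟨h7, h8⟩
        · have := huniq u (i + 1 + 1) hul (mem_nonEntries.2 ⟨h4.1, h4.2.1⟩) huv
            (by rw [par_of_forced h4]; omega)
          omega
        · omega
      · exact absurd h5 h3
      · rcases hvi with rfl | ⟨h7, h8⟩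
        · exact h6
        · exact absurd h8 h4
    rw [hτi, hτi', huv]
  have hbackpar : ∀ i j, a ≤ i → i ≤ b → j < l → i < j → D.Adj (p j) (p i) →
      par D p l i = j ∧ ¬ Forced D p l i := by
    intro i j h1 h2 h3 h4 h5
    obtain ⟨hn, hs, hm, -⟩ := info i h1 h2
    have hj : j ∈ backIn D p l i := mem_backIn.2 ⟨h3, h4, h5⟩
    refine ⟨(eq_par_of_mem_backIn hn hm hj).symm, fun hF => ?_⟩
    rw [hF.2.2] at hj
    simp at hj
  have hback : ∀ i j, a ≤ i → i ≤ b → j < l → i < j → D.Adj (p j) (p i) →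
      τ i < b ∧ j = τ (τ i + 1) ∨ τ i = b ∧ b < j := by
    intro i j h1 h2 h3 h4 h5
    obtain ⟨h6, h7⟩ := hbackpar i j h1 h2 h3 h4 h5
    have hw := hwin i h1 h2
    rcases hw.2.lt_or_eq with h8 | h8
    · left
      refine ⟨h8, ?_⟩
      have h9 : ¬ Forced D p l (τ i + 1) := by
        rcases hcase i with ⟨h10, h11⟩ | ⟨h10, h11, h12⟩ | ⟨h10, h11, h12⟩
        · rw [h11]
          exact hsucc _ h10
        · exact absurd h11 h7
        · rwa [h12]
      rw [← hpar (τ i) hw.1 h8 h9, hττ, h6]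
    · right
      refine ⟨h8, ?_⟩
      by_contra! hle
      have h9 := hnear i
      obtain rfl : j = i + 1 := by omega
      rcases hcase i with ⟨h10, h11⟩ | ⟨h10, h11, h12⟩ | ⟨h10, h11, h12⟩
      · exact hpred i ⟨h10, h5⟩
      · omega
      · omega
  have hm : 0 < b - a + 1 := by omega
  set g : ℕ → V := fun j => p (a + j) with hg
  -- The path `Q` visits the blocks in reverse order, each block in forward order. It starts at `p
  -- (τ b)` and ends at `p (τ a)`.
  set h : ℕ → V := fun j => p (τ (b - j)) with hh
  have hτl : ∀ i, a ≤ i → i ≤ b → τ i < l := fun i h1 h2 => (hwin i h1 h2).2.trans_lt hbl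
  have ginj : ∀ i < b - a + 1, ∀ j < b - a + 1, g i = g j → i = j := by
    intro i hi j hj hij
    have := hP.inj _ (by omega) _ (by omega) hij
    omega
  have hinj : ∀ i < b - a + 1, ∀ j < b - a + 1, h i = h j → i = j := by
    intro i hi j hj hij
    have h1 := hP.inj _ (hτl _ (by omega) (by omega)) _ (hτl _ (by omega) (by omega)) hij
    have h2 := congrArg τ h1
    rw [hττ, hττ] at h2
    omega
  have gadj : ∀ i, i + 1 < b - a + 1 → D.Adj (g i) (g (i + 1)) := fun i hi =>
    hP.adj (a + i) (by omega)
  have hadj : ∀ i, i + 1 < b - a + 1 → D.Adj (h i) (h (i + 1)) := by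
    intro i hi
    obtain ⟨k, hk⟩ : ∃ k, b - i = k + 1 := ⟨b - i - 1, by omega⟩
    have hk' : b - (i + 1) = k := by omega
    simp only [hh, hk, hk']
    by_cases hF : Forced D p l (k + 1)
    · rcases hcase k with ⟨h1, h2⟩ | ⟨h1, -⟩ | ⟨h1, -⟩
      · rcases hcase (k + 1) with ⟨h3, -⟩ | ⟨-, -, h3⟩ | ⟨-, h3, -⟩
        · exact absurd h3 (hsucc _ h1)
        · rw [h2, show τ (k + 1) = k by omega]
          exact hP.adj k (by omega)
        · exact absurd h1 h3
      · exact absurd hF h1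
      · exact absurd hF h1
    · rw [← hpar k (by omega) (by omega) hF]
      have hw := hwin k (by omega) (by omega)
      have := (info (τ k) hw.1 hw.2).1
      exact (hP.par_spec (mem_nonEntries.1 this).1 (mem_nonEntries.1 this).2).2
  have gfwd : ∀ i < b - a + 1, ∀ j < b - a + 1, D.Adj (g i) (g j) → j ≤ i + 1 := by
    intro i hi j hj hij
    have := hP.fwd _ (by omega) _ (by omega) hij
    omega
  have hfwd : ∀ i < b - a + 1, ∀ j < b - a + 1, D.Adj (h i) (h j) → j ≤ i + 1 := by
    intro i hi j hj hij
    have hi' := hwin (b - i) (by omega) (by omega)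
    have hj' := hwin (b - j) (by omega) (by omega)
    have h1 := hP.fwd _ (by omega) _ (by omega) hij
    have h2 := hnear (b - i)
    have h3 := hnear (b - j)
    rcases Nat.lt_or_ge (τ (b - j)) (τ (b - i)) with h4 | h4
    · rcases hback _ _ hj'.1 hj'.2 (by omega) h4 hij with ⟨h5, h6⟩ | ⟨h5, h6⟩
      · have h7 := congrArg τ h6
        rw [hττ, hττ, hττ] at h7
        omega
      · omega
    · have hne : τ (b - j) ≠ τ (b - i) := fun hne => by
        simp only [hh, hne] at hij
        exact hred.not_adj_self _ hij
      omega
  have memP : ∀ x, x ∈ (List.range (b - a + 1)).map g ↔ ∃ i, a ≤ i ∧ i ≤ b ∧ x = p i := by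
    intro x
    simp only [List.mem_map, List.mem_range, hg]
    constructor
    · rintro ⟨i, hi, rfl⟩
      exact ⟨a + i, by omega, by omega, rfl⟩
    · rintro ⟨i, h1, h2, rfl⟩
      exact ⟨i - a, by omega, by rw [show a + (i - a) = i by omega]⟩
  have notMemP : ∀ i < l, (i < a ∨ b < i) → p i ∉ (List.range (b - a + 1)).map g := by
    intro i hi hib hmem
    obtain ⟨j, h1, h2, h3⟩ := (memP _).1 hmem
    have := hP.inj i hi j (by omega) h3
    omega
  have h0 : h 0 = p (τ b) := rfl
  have g0 : g 0 = p a := rfl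
  have glast : g (b - a + 1 - 1) = p b := by
    simp only [hg]
    congr 1
    omega
  have hwa := hwin a le_rfl (by omega)
  have hwb := hwin b (by omega) le_rfl
  refine ⟨(List.range (b - a + 1)).map g, (List.range (b - a + 1)).map h, p a, p b, p (τ b),
    p (τ a), ⟨?_, ?_, ?_, ?_, ?_, ?_, ?_, ?_, ?_, ?_⟩⟩
  · simp only [List.length_map, List.length_range]
    omega
  · rw [← g0, ← glast]
    exact isPath_map_range hm ginj gadj
  · rcases hcase b with ⟨h1, -⟩ | ⟨-, -, h1⟩ | ⟨-, -, h1⟩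
    · exact absurd h1 hbF
    · left
      have : b - a + 1 - 2 < b - a + 1 := by omega
      simp only [List.length_map, List.length_range, List.getElem?_map,
        List.getElem?_range this, Option.map_some, hg]
      congr 2
      omega
    · right
      rw [h1]
  · rcases hcase a with ⟨-, h1⟩ | ⟨-, h1, -⟩ | ⟨-, -, h1⟩
    · right
      have : 1 < b - a + 1 := by omega
      simp only [List.getElem?_map, List.getElem?_range this, Option.map_some, hg, h1]
    · exact absurd h1 haF
    · left
      rw [h1]
  · intro x hx
    obtain ⟨i, hai, hib, rfl⟩ := (memP x).1 hx
    have hil : i < l := by omega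
    obtain ⟨hn, -⟩ := info i hai hib
    constructor
    · rintro ⟨y, hy, hyi⟩
      have ho : ¬ Outside p l y := fun ho => (mem_nonEntries.1 hn).2 ⟨y, ho, hyi⟩
      obtain ⟨j, hj, rfl⟩ := not_outside.1 ho
      have h1 := hP.fwd j hj i hil hyi
      have h2 : j < a ∨ b < j := by
        by_contra! hjab
        exact hy ((memP _).2 ⟨j, by omega, by omega, rfl⟩)
      rcases h2 with h2 | h2
      · left
        rw [show i = a by omega]
      · right
        rcases hback i j hai hib hj (by omega) hyi with ⟨h3, h4⟩ | ⟨h3, h4⟩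
        · have := hwin (τ i + 1) (by have := hwin i hai hib; omega) h3
          omega
        · rw [← h3, hττ]
    · rintro (hia | hib')
      · obtain rfl := hP.inj i hil a (by omega) hia
        have hpos := hP.pos_of_not_entry (mem_nonEntries.1 hn).2
        have h1 := hP.adj (i - 1) (by omega)
        rw [show i - 1 + 1 = i by omega] at h1
        exact ⟨p (i - 1), notMemP _ (by omega) (by omega), h1⟩
      · obtain rfl := hP.inj i hil (τ b) (by omega) hib'
        have hnF : ¬ Forced D p l (τ b) := by
          rcases hcase (τ b) with ⟨h1, h2⟩ | ⟨h1, h2, h3⟩ | ⟨h1, h2, h3⟩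
          · exact fun h3 => hsucc _ h3 h1
          · rw [hττ] at h3
            omega
          · exact h2
        have hne : (backIn D p l (τ b)).Nonempty := by
          rw [Finset.nonempty_iff_ne_empty]
          exact fun h => hnF ⟨hil, (mem_nonEntries.1 hn).2, h⟩
        obtain ⟨h1, h2, h3⟩ := mem_backIn.1 (par_mem_backIn hne)
        rcases hback _ _ hai hib h1 h2 h3 with ⟨h4, -⟩ | ⟨-, h4⟩
        · rw [hττ] at h4
          omega
        · exact ⟨_, notMemP _ h1 (.inr h4), h3⟩
  · intro x hx
    obtain ⟨i, hai, hib, rfl⟩ := (memP x).1 hx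
    have hil : i < l := by omega
    obtain ⟨hn, -, -, -, huniq, hex, htar, hi1⟩ := info i hai hib
    constructor
    · rintro ⟨y, hy, hyi⟩
      have ho : ¬ Outside p l y := fun ho => htar y (outside_mem_targets hil ho hyi) hyi
      obtain ⟨j, hj, rfl⟩ := not_outside.1 ho
      have h1 := hP.fwd i hil j hj hyi
      have h2 : j < a ∨ b < j := by
        by_contra! hjab
        exact hy ((memP _).2 ⟨j, by omega, by omega, rfl⟩)
      rcases h2 with h2 | h2
      · right
        have hjE : ¬ Entry D p l j := fun h => htar _ (mem_targets_of_index hj (.inl h)) hyi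
        have hjm : j ∉ multiBack D p l := fun h => htar _ (mem_targets_of_index hj (.inr h)) hyi
        have hjn : j ∈ nonEntries D p l := mem_nonEntries.2 ⟨hj, hjE⟩
        have hji : par D p l j = i :=
          (eq_par_of_mem_backIn hjn hjm (mem_backIn.2 ⟨hil, by omega, hyi⟩)).symm
        have hw := hwin i hai hib
        -- Otherwise `i` already has a child inside the window, and `j` would be a second child of a
        -- vertex that does not branch.
        have hτa : τ i = a := by
          by_contra hne
          obtain ⟨k, hk⟩ : ∃ k, τ i = k + 1 := ⟨τ i - 1, by omega⟩
          by_cases hF : Forced D p l (k + 1)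
          · have h3 : τ (k + 1) = i := by rw [← hk, hττ]
            rcases hcase (k + 1) with ⟨h4, -⟩ | ⟨-, -, h4⟩ | ⟨-, h4, -⟩
            · exact hsucc _ hF h4
            · have := huniq j (k + 1) hjn (mem_nonEntries.2 ⟨hF.1, hF.2.1⟩) hji
                (by rw [par_of_forced hF]; omega)
              omega
            · exact h4 hF
          · have h3 := hpar k (by omega) (by omega) hF
            rw [← hk, hττ] at h3
            have h4 := hwin k (by omega) (by omega)
            have := huniq j (τ k) hjn (info _ h4.1 h4.2).1 hji h3
            omega
        rw [← hτa, hττ]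
      · left
        rw [show i = b by omega]
    · rintro (hib' | hia)
      · obtain rfl := hP.inj i hil b hbl hib'
        exact ⟨p (i + 1), notMemP _ hi1 (by omega), hP.adj i hi1⟩
      · obtain rfl := hP.inj i hil (τ a) (by omega) hia
        obtain ⟨k, hk, hka⟩ := hex
        have hk' := mem_nonEntries.1 hk
        have hkadj := (hP.par_spec hk'.1 hk'.2).2
        rw [hka] at hkadj
        refine ⟨p k, notMemP k hk'.1 ?_, hkadj⟩
        -- A child of `τ a` inside the window could only be the other vertex of the first block,
        -- which sends no arc back, or the next vertex. The latter would then be forced, contrary to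
        -- the choice of blocks.
        by_contra! hkab
        have hkne : τ a ≠ k := by
          intro h
          rw [h] at hkadj
          exact hred.not_adj_self _ hkadj
        have h1 := hP.fwd _ hil _ hk'.1 hkadj
        rcases hcase a with ⟨h2, h3⟩ | ⟨-, h2, -⟩ | ⟨h2, -, h3⟩
        · rcases Nat.lt_or_ge k (τ a) with h4 | h4
          · obtain rfl : k = a := by omega
            rw [h3] at hkadj
            exact hpred _ ⟨h2, hkadj⟩
          · obtain rfl : k = a + 1 + 1 := by omega
            refine hsucc _ h2 ⟨hk'.1, hk'.2, ?_⟩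
            by_contra hne
            have := (mem_backIn.1 (par_mem_backIn (Finset.nonempty_iff_ne_empty.2 hne))).2.1
            omega
        · exact haF h2
        · obtain rfl : k = a + 1 := by omega
          refine h2 ⟨hk'.1, hk'.2, ?_⟩
          by_contra hne
          have := (mem_backIn.1 (par_mem_backIn (Finset.nonempty_iff_ne_empty.2 hne))).2.1
          omega
  · intro T
    rw [← g0]
    refine isOutBranchingOn_iff_of_noJump hm ginj gadj gfwd _ (fun x => ?_) T
    simp [eq_comm]
  · exact ⟨_, h0 ▸ isPath_map_range hm hinj hadj⟩
  · intro T
    rw [← h0]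
    refine isOutBranchingOn_iff_of_noJump hm hinj hadj hfwd _ (fun x => ?_) T
    change x ∈ (List.range (b - a + 1)).map g ↔ _
    rw [memP]
    constructor
    · rintro ⟨i, h1, h2, rfl⟩
      have hw := hwin i h1 h2
      refine ⟨b - τ i, by omega, ?_⟩
      simp only [hh]
      rw [show b - (b - τ i) = τ i by omega, hττ]
    · rintro ⟨i, hi, rfl⟩
      have hw := hwin (b - i) (by omega) (by omega)
      exact ⟨_, hw.1, hw.2, rfl⟩
  · intro x y hx hy
    obtain ⟨i, hi, h1, rfl⟩ := arcOf_map_range.1 hx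
    obtain ⟨j, hj, h2, rfl⟩ := arcOf_map_range.1 hy
    have h3 := hP.inj _ (by omega) _ (by omega) h1
    have h4 := hP.inj _ hbl _ (hτl _ (by omega) (by omega)) h2
    have h5 := congrArg τ h4
    rw [hττ] at h5
    intro h6
    have h7 := hP.inj _ (by omega) _ (hτl _ (by omega) (by omega)) h6
    -- The successor of `pOut` on `P` has index at most `a + 2`, and that of `pₗ` on `Q` at least `b
    -- - 3`. These differ because `b ≥ a + 6`.
    have h8 := hnear (b - (j + 1))
    have h9 := hnear a
    have h10 := hnear b
    omega

end IsIsolatedPath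

end Window

/-! ### The length of an isolated path -/

section Length

variable {V : Type*} [Fintype V] {D : Digraph V} {r : V} {p : ℕ → V} {l n : ℕ}

theorem IsIsolatedPath.card_marks_le (hP : IsIsolatedPath D r p l) (hred : IsReduced D r)
    (hno : ¬ IsYesInstance D r (n + 1)) : (marks D p l).card ≤ 84 * n ^ 2 + 8 * n + 1 := by
  have h1 := hP.card_cuts_le hred hno
  have h2 := hP.card_branching_le hred hno
  have h3 := hP.card_forestLeaves_le hred hno
  have h4 := hP.card_ports_le hred hno
  have h5 := Finset.card_union_le (cuts D p l) (branching D p l)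
  have h6 := Finset.card_union_le (cuts D p l ∪ branching D p l) (forestLeaves D p l)
  have h7 := Finset.card_union_le (cuts D p l ∪ branching D p l ∪ forestLeaves D p l) (ports D p l)
  have h8 := Finset.card_union_le
    (cuts D p l ∪ branching D p l ∪ forestLeaves D p l ∪ ports D p l) {l - 1}
  rw [Finset.card_singleton] at h8
  rw [marks]
  omega

/-- In a reduced no-instance, every isolated path is short. -/
theorem IsIsolatedPath.length_le (hP : IsIsolatedPath D r p l) (hred : IsReduced D r)
    (hno : ¬ IsYesInstance D r (n + 1)) : l ≤ 756 * n ^ 2 + 72 * n + 17 := by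
  have hm := hP.card_marks_le hred hno
  -- Nine vertices leave room to adjust each end by one, so that a window of seven or eight cuts no
  -- block. Hence `l / 9` is at most the number of marks, and `9 (84n² + 8n + 1) + 8` is the stated
  -- bound.
  have hgap : ∀ q ∈ Finset.range (l / 9), ∃ i ∈ marks D p l, 9 * q ≤ i ∧ i < 9 * q + 9 := by
    intro q hq
    rw [Finset.mem_range] at hq
    by_contra! hne
    have hmark : ∀ i, 9 * q ≤ i → i < 9 * q + 9 → i ∉ marks D p l := fun i h1 h2 h3 => by
      have := hne i h3 h1
      omega
    obtain ⟨b, h1, h2, h3⟩ : ∃ b, 9 * q + 7 ≤ b ∧ b ≤ 9 * q + 8 ∧ ¬ Forced D p l (b + 1) := by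
      by_cases h : Forced D p l (9 * q + 8 + 1)
      · exact ⟨9 * q + 7, le_rfl, by omega, fun h' => hP.not_forced_succ hred h' h⟩
      · exact ⟨9 * q + 8, by omega, le_rfl, h⟩
    obtain ⟨a, h4, h5⟩ : ∃ a, (b = a + 6 ∨ b = a + 7) ∧ ¬ Forced D p l a := by
      by_cases h : Forced D p l (b - 6)
      · refine ⟨b - 7, by omega, fun h' => hP.not_forced_succ hred h' ?_⟩
        rwa [show b - 7 + 1 = b - 6 by omega]
      · exact ⟨b - 6, by omega, h⟩
    exact hred.two_directional_path (hP.twoDirectionalPathRuleApplies hred h4 (by omega)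
      (fun i hi hi' => hmark i (by omega) (by omega)) h5 h3)
  choose! f hf hf1 hf2 using hgap
  have hcard := Finset.card_le_card_of_injOn f hf (fun q hq q' hq' h => by
    have h1 := hf1 q hq
    have h2 := hf2 q hq
    have h3 := hf1 q' hq'
    have h4 := hf2 q' hq'
    omega)
  rw [Finset.card_range] at hcard
  omega

end Length

/-! ### From the breadth-first tree to isolated paths -/

section Decomposition

variable {V : Type*} {D : Digraph V} {r : V} {t : V → V} {d : V → ℕ}

/-- A chain of vertices without branching in a breadth-first search tree is contained
in an isolated path. -/
theorem exists_isIsolatedPath (hred : IsReduced D r) (htr : t r = r)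
    (ht : ∀ v, v ≠ r → D.Adj (t v) v ∧ d v = d (t v) + 1)
    (hd : ∀ u v, D.Adj u v → d v ≤ d u + 1) {a : V} {L : ℕ} (hL : 0 < L)
    (hroot : ∀ i, 1 ≤ i → i ≤ L → t^[i] a ≠ r)
    (hone : ∀ i, 1 ≤ i → i ≤ L → ∀ w w', w ≠ r → w' ≠ r → t w = t^[i] a → t w' = t^[i] a → w = w') :
    ∃ p l, L ≤ l ∧ IsIsolatedPath D r p l := by
  have ha : a ≠ r := by
    rintro rfl
    exact hroot 1 le_rfl hL htr
  have hroot' : ∀ i ≤ L, t^[i] a ≠ r := by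
    intro i hi
    rcases i with _ | i
    · exact ha
    · exact hroot _ (by omega) hi
  set p : ℕ → V := fun i => t^[L - i] a with hp
  have hpL : p L = a := by simp [hp]
  have hpr : ∀ i, p i ≠ r := fun i => hroot' _ (by omega)
  have hpt : ∀ i < L, t (p (i + 1)) = p i := by
    intro i hi
    simp only [hp]
    rw [← Function.iterate_succ_apply' t, show L - i = (L - (i + 1)).succ by omega]
  have hdit : ∀ i ≤ L, d (t^[i] a) + i = d a := by
    intro i
    induction i with
    | zero => simp
    | succ i ih =>
      intro hi
      have h1 := ih (by omega)
      have h2 := (ht _ (hroot' i (by omega))).2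
      rw [Function.iterate_succ_apply']
      omega
  have hdp : ∀ i ≤ L, d (p i) + (L - i) = d a := fun i _ => hdit _ (by omega)
  have hmono : ∀ m v, d (t^[m] v) ≤ d v := by
    intro m
    induction m with
    | zero => exact fun v => le_rfl
    | succ m ih =>
      intro v
      rw [Function.iterate_succ_apply]
      refine (ih _).trans ?_
      by_cases hv : v = r
      · rw [hv, htr]
      · have := (ht v hv).2
        omega
  have base : ∀ l, 0 < l → l ≤ L + 1 →
      (∀ v, Outside p l v → ReflTransGen (fun x y => D.Adj x y ∧ Outside p l y) r v) →
      IsIsolatedPath D r p l := by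
    intro l hl0 hl hreach
    refine ⟨?_, ?_, ?_, fun i _ h => hpr i h.symm, hl0, ?_, hreach⟩
    · intro i hi j hj h
      have h1 := hdp i (by omega)
      have h2 := hdp j (by omega)
      rw [h] at h1
      omega
    · intro i hi
      have := (ht _ (hpr (i + 1))).1
      rwa [hpt i (by omega)] at this
    · intro i hi j hj h
      have h1 := hdp i (by omega)
      have h2 := hdp j (by omega)
      have h3 := hd _ _ h
      omega
    · obtain ⟨h1, h2⟩ := ht _ (hpr 0)
      refine ⟨t (p 0), fun i hi h => ?_, h1⟩
      have h3 := hdp i (by omega)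
      have h4 := hdp 0 (by omega)
      rw [h] at h2
      omega
  have hchild : ∀ v, v ≠ r → Outside p L v → ¬ Outside p L (t v) → v = a := by
    intro v hv ho hto
    obtain ⟨i, hi, hti⟩ := not_outside.1 hto
    have h1 := hone (L - i) (by omega) (by omega) v (p (i + 1)) hv (hpr _) hti (hpt i hi)
    rcases Nat.lt_or_ge (i + 1) L with h2 | h2
    · exact absurd h1 (ho _ h2)
    · rw [h1, show i + 1 = L by omega, hpL]
  -- vertices that do not descend from `a`
  have hT1 : ∀ m v, d v = m → Outside p L v → (∀ j, t^[j] v ≠ a) →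
      ReflTransGen (fun x y => D.Adj x y ∧ Outside p L y ∧ y ≠ a) r v := by
    intro m
    induction m using Nat.strong_induction_on with
    | _ m ih =>
      intro v hm ho hna
      by_cases hv : v = r
      · rw [hv]
      · obtain ⟨h1, h2⟩ := ht v hv
        have h3 : Outside p L (t v) := by
          by_contra h3
          exact hna 0 (hchild v hv ho h3)
        exact (ih _ (by omega) (t v) rfl h3 fun j => hna (j + 1)).tail ⟨h1, ho, hna 0⟩
  have hdesc : ∀ m v, t^[m] v = a → Outside p L v := by
    intro m v h i hi h'
    have h1 := hmono m v
    have h2 := hdp i (by omega)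
    rw [h, h'] at h1
    omega
  have hT2 : ∀ m v, t^[m] v = a →
      ReflTransGen (fun x y => D.Adj x y ∧ Outside p L y) a v := by
    intro m
    induction m with
    | zero =>
      rintro v rfl
      exact .refl
    | succ m ih =>
      intro v h
      have hv : v ≠ r := by
        rintro rfl
        rw [Function.iterate_fixed htr] at h
        exact ha h.symm
      exact (ih (t v) h).tail ⟨(ht v hv).1, hdesc (m + 1) v h⟩
  -- Descendants of `a` are at least as deep as `a`, and arcs raise depth by at most one. So the
  -- only arc from the chain into the subtree of `a` is the tree arc into `a`.
  have hcross : ∀ m u v, ¬ Outside p L u → D.Adj u v → t^[m] v = a → v = a ∧ u = t a := by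
    intro m u v hu huv hva
    obtain ⟨i, hi, rfl⟩ := not_outside.1 hu
    have h1 := hd _ _ huv
    have h2 := hdp i (by omega)
    have h3 : v = a := by
      rcases m with _ | m
      · exact hva
      · by_cases hv : v = r
        · rw [hv, Function.iterate_fixed htr] at hva
          exact absurd hva.symm ha
        · have h4 := hmono m (t v)
          have h5 := (ht v hv).2
          rw [Function.iterate_succ_apply] at hva
          rw [hva] at h4
          omega
    refine ⟨h3, ?_⟩
    rw [h3] at h1
    have h4 := hpt i hi
    rw [show i + 1 = L by omega, hpL] at h4
    exact h4.symm
  -- If `a` can be reached without the chain, the chain itself is isolated. Otherwise the arc from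
  -- `t a` disconnects `a`, hence no other vertex by the Bridge rule, and adding `a` to the chain
  -- makes it isolated.
  by_cases hA : ReflTransGen (fun x y => D.Adj x y ∧ Outside p L y) r a
  · refine ⟨p, L, le_rfl, base L hL (by omega) fun v ho => ?_⟩
    by_cases hva : ∃ m, t^[m] v = a
    · obtain ⟨m, hm⟩ := hva
      exact hA.trans (hT2 m v hm)
    · push Not at hva
      exact reflTransGen_mono (hT1 _ v rfl ho hva) fun x y h => ⟨h.1, h.2.1⟩
  · have houta : Outside p L a := hdesc 0 a rfl
    have hbridge : ArcDisconnects D r (t a) a a := by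
      by_contra hnd
      have key : ∀ v, ReflTransGen (fun x y => D.Adj x y ∧ ¬ (x = t a ∧ y = a)) r v →
          ¬ Outside p L v ∨ ReflTransGen (fun x y => D.Adj x y ∧ Outside p L y) r v := by
        intro v hv
        induction hv with
        | refl => exact .inr .refl
        | @tail u v _ huv ih =>
          by_cases ho : Outside p L v
          · right
            rcases ih with ih | ih
            · by_cases hva : ∃ m, t^[m] v = a
              · obtain ⟨m, hm⟩ := hva
                obtain ⟨h1, h2⟩ := hcross m u v ih huv.1 hm
                exact absurd ⟨h2, h1⟩ huv.2
              · push Not at hva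
                exact reflTransGen_mono (hT1 _ v rfl ho hva) fun x y h => ⟨h.1, h.2.1⟩
            · exact ih.tail ⟨huv.1, ho⟩
          · exact .inl ho
      rcases key a (reflTransGen_of_not_arcDisconnects hnd) with h | h
      · exact h houta
      · exact hA h
    refine ⟨p, L + 1, by omega, base _ (by omega) le_rfl fun w hw => ?_⟩
    have hwo : Outside p L w := fun i hi => hw i (by omega)
    have hwa : w ≠ a := hpL ▸ hw L (by omega)
    have hnd : ¬ ArcDisconnects D r (t a) a w := fun h =>
      hred.bridge ⟨t a, a, (ht a ha).1, a, w, hwa.symm, hbridge, h⟩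
    have key : ∀ v, ReflTransGen (fun x y => D.Adj x y ∧ ¬ (x = t a ∧ y = a)) r v →
        ¬ Outside p L v ∨
          ReflTransGen (fun x y => D.Adj x y ∧ Outside p L y ∧ y ≠ a) r v := by
      intro v hv
      induction hv with
      | refl => exact .inr .refl
      | @tail u v _ huv ih =>
        by_cases ho : Outside p L v
        · right
          rcases ih with ih | ih
          · by_cases hva : ∃ m, t^[m] v = a
            · obtain ⟨m, hm⟩ := hva
              obtain ⟨h1, h2⟩ := hcross m u v ih huv.1 hm
              exact absurd ⟨h2, h1⟩ huv.2
            · push Not at hva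
              exact hT1 _ v rfl ho hva
          · refine ih.tail ⟨huv.1, ho, ?_⟩
            rintro rfl
            exact hA ((reflTransGen_mono ih fun x y h => ⟨h.1, h.2.1⟩).tail ⟨huv.1, ho⟩)
        · exact .inl ho
    rcases key w (reflTransGen_of_not_arcDisconnects hnd) with h | h
    · exact absurd hwo h
    · refine reflTransGen_mono h fun x y hxy => ⟨hxy.1, fun i hi => ?_⟩
      rcases Nat.lt_or_ge i L with h1 | h1
      · exact hxy.2.1 i h1
      · rw [show i = L by omega, hpL]
        exact hxy.2.2

/-- The number of vertices of a reduced no-instance. -/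
theorem card_le_of_reduced [Fintype V] {n : ℕ} (hred : IsReduced D r)
    (hno : ¬ IsYesInstance D r (n + 1)) :
    Fintype.card V + 756 * n ^ 2 + 72 * n + 17 ≤ 2 * n * (756 * n ^ 2 + 72 * n + 18) := by
  have := Classical.decEq V
  obtain ⟨d, t₀, ht₀, hd₀⟩ := exists_bfs D.Adj r
  have hd : ∀ u v, D.Adj u v → d v ≤ d u + 1 := fun u v => hd₀ u v (hred.reachable u)
  let t : V → V := fun v => if v = r then r else t₀ v
  have htr : t r = r := if_pos rfl
  have ht : ∀ v, v ≠ r → D.Adj (t v) v ∧ d v = d (t v) + 1 := by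
    intro v hv
    simp only [t, if_neg hv]
    exact (ht₀ v (hred.reachable v) hv).2
  set N : Finset V := Finset.univ.erase r with hN
  have memN : ∀ {v}, v ∈ N ↔ v ≠ r := by simp [hN]
  set Lf : Finset V := Finset.univ.filter fun v => ∀ w ∈ N, t w ≠ v with hLf
  set Br : Finset V := Finset.univ.filter fun v => 2 ≤ (N.filter (t · = v)).card with hBr
  have hleaf : Lf.card ≤ n := by
    refine le_trans (le_of_eq ?_)
      (ncard_leaves_le hno t d fun v hv => ⟨(ht v hv).1, by have := (ht v hv).2; omega⟩)
    rw [← Set.ncard_coe_finset]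
    congr 1
    ext v
    simp [hLf, memN]
  have hcount : 1 + Br.card ≤ n := by
    have h1 := card_roots_add_card_branching_le Finset.univ N t (Finset.subset_univ _)
      (fun x _ => Finset.mem_univ _)
    have h2 : (Finset.univ \ N).card = 1 := by
      rw [Finset.card_eq_one]
      refine ⟨r, ?_⟩
      ext v
      simp [memN]
    rw [h2] at h1
    refine le_trans (le_of_eq ?_) (h1.trans (le_trans (le_of_eq ?_) hleaf))
    · congr 2
    · congr 1
      ext v
      simp [hLf]
  set M := 756 * n ^ 2 + 72 * n + 17 with hM
  -- Descend through only children until a leaf or branching vertex `a` is met. The number `m`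
  -- bounds the remaining depth and drives the induction.
  have hcover : ∀ m v, (∀ w, d w ≤ d v + m) → v ≠ r → v ∉ Lf ∪ Br →
      ∃ a ∈ Lf ∪ Br, ∃ j, 1 ≤ j ∧ t^[j] a = v ∧ (∀ i, 1 ≤ i → i ≤ j → t^[i] a ≠ r) ∧
        ∀ i, 1 ≤ i → i ≤ j → ∀ w w', w ≠ r → w' ≠ r → t w = t^[i] a → t w' = t^[i] a →
          w = w' := by
    intro m
    induction m with
    | zero =>
      intro v hmax _ hvU
      simp only [Finset.mem_union, not_or, hLf, Finset.mem_filter, Finset.mem_univ, true_and] at hvU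
      push Not at hvU
      obtain ⟨⟨c, hc, rfl⟩, -⟩ := hvU
      have h1 := (ht c (memN.1 hc)).2
      have h2 := hmax c
      omega
    | succ m ih =>
      intro v hmax hv hvU
      have hvU' := hvU
      simp only [Finset.mem_union, not_or, hLf, hBr, Finset.mem_filter, Finset.mem_univ,
        true_and] at hvU'
      push Not at hvU'
      obtain ⟨⟨c, hc, rfl⟩, hkid⟩ := hvU'
      have hcr := memN.1 hc
      have huniq : ∀ w w', w ≠ r → w' ≠ r → t w = t c → t w' = t c → w = w' := by
        intro w w' hw hw' h h'
        by_contra hne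
        have : 1 < (N.filter (t · = t c)).card := Finset.one_lt_card.2
          ⟨w, Finset.mem_filter.2 ⟨memN.2 hw, h⟩, w', Finset.mem_filter.2 ⟨memN.2 hw', h'⟩, hne⟩
        omega
      by_cases hcU : c ∈ Lf ∪ Br
      · refine ⟨c, hcU, 1, le_rfl, rfl, fun i h1 h2 => ?_, fun i h1 h2 => ?_⟩ <;>
        · obtain rfl : i = 1 := by omega
          assumption
      · obtain ⟨a, ha, j, hj, hja, h1, h2⟩ := ih c (fun w => by
          have h1 := (ht c hcr).2
          have h2 := hmax w
          omega) hcr hcU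
        have hj1 : t^[j + 1] a = t c := by rw [Function.iterate_succ_apply', hja]
        refine ⟨a, ha, j + 1, by omega, hj1, fun i h3 h4 => ?_, fun i h3 h4 => ?_⟩
        · rcases h4.lt_or_eq with h5 | rfl
          · exact h1 i h3 (by omega)
          · rwa [hj1]
        · rcases h4.lt_or_eq with h5 | rfl
          · exact h2 i h3 (by omega)
          · rwa [hj1]
  have hsub : (Finset.univ : Finset V) ⊆ {r} ∪ (Lf ∪ Br) ∪
      ((Lf ∪ Br) ×ˢ Finset.Icc 1 M).image fun x => t^[x.2] x.1 := by
    intro v _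
    simp only [Finset.mem_union (s := {r} ∪ (Lf ∪ Br)), Finset.mem_union (s := {r}),
      Finset.mem_singleton]
    by_cases hv : v = r
    · exact .inl (.inl hv)
    by_cases hvU : v ∈ Lf ∪ Br
    · exact .inl (.inr hvU)
    right
    obtain ⟨a, ha, j, hj, hja, h1, h2⟩ := hcover (Finset.univ.sup d) v
      (fun w => by
        have := Finset.le_sup (f := d) (Finset.mem_univ w)
        omega) hv hvU
    obtain ⟨p, l, hl, hP⟩ := exists_isIsolatedPath hred htr ht hd hj h1 h2
    have := hP.length_le hred hno
    exact Finset.mem_image.2 ⟨(a, j), Finset.mem_product.2 ⟨ha, Finset.mem_Icc.2 ⟨hj, by omega⟩⟩,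
      hja⟩
  have h1 := Finset.card_le_card hsub
  have h2 := Finset.card_union_le ({r} ∪ (Lf ∪ Br))
    (((Lf ∪ Br) ×ˢ Finset.Icc 1 M).image fun x => t^[x.2] x.1)
  have h3 := Finset.card_union_le {r} (Lf ∪ Br)
  have h4 : (((Lf ∪ Br) ×ˢ Finset.Icc 1 M).image fun x => t^[x.2] x.1).card
      ≤ (Lf ∪ Br).card * M := by
    refine Finset.card_image_le.trans ?_
    rw [Finset.card_product, Nat.card_Icc]
    simp
  have h5 := Finset.card_union_le Lf Br
  rw [Finset.card_univ] at h1
  rw [Finset.card_singleton] at h3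
  -- This combines `|Lf| ≤ n` and `|Br| + 1 ≤ n`. Each leaf or branching vertex accounts for itself
  -- and at most `M` ancestors.
  have h6 : (Lf ∪ Br).card + 1 ≤ 2 * n := by omega
  have h7 := Nat.mul_le_mul_right (M + 1) h6
  calc Fintype.card V + 756 * n ^ 2 + 72 * n + 17 = Fintype.card V + M := by omega
    _ ≤ ((Lf ∪ Br).card + 1) * (M + 1) := by
      have : ((Lf ∪ Br).card + 1) * (M + 1) = (Lf ∪ Br).card * M + (Lf ∪ Br).card + M + 1 := by ring
      omega
    _ ≤ _ := h7

end Decomposition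

end RootedLeaf

theorem mainTheorem2 {V : Type*} [Fintype V] (D : Digraph V) (r : V) (k : ℕ)
    (hred : RootedLeaf.IsReduced D r) (hno : ¬ RootedLeaf.IsYesInstance D r k) :
    Fintype.card V ≤ 1540 * k ^ 3 := by
  rcases k with _ | n
  -- For `k = 0` the bound with `n = 0` reads `|V| + 17 ≤ 0`, so this case cannot occur.
  · have hno' : ¬ RootedLeaf.IsYesInstance D r (0 + 1) := fun ⟨T, hT, _⟩ =>
      hno ⟨T, hT, Nat.zero_le _⟩
    have := RootedLeaf.card_le_of_reduced hred hno'
    omega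
  · have := RootedLeaf.card_le_of_reduced hred hno
    nlinarith [sq_nonneg n, pow_nonneg (Nat.zero_le n) 3]
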